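/- Let $R$ be a complete discrete valuation ring with fraction field $K$, normalized valuation $v_R$ (extended to $K$, with $v_R(0)=\infty$) and finite residue field of cardinality $q$. Let $d\ge 1$ be an integer and let $\mu$ be the Haar probability measure on the compact additive group $\Omega=M_d(R)$ of $d\times d$ matrices over $R$. An LU decomposition of $M\in M_d(K)$ is a factorization $M=L(M)\,U(M)$ in which $L(M)\in M_d(K)$ is lower triangular with all diagonal entries equal to $1$ and $U(M)\in M_d(K)$ is upper triangular. For $\mu$-almost every $\omega\in\Omega$ there is exactly one LU decomposition of $\omega$ over $K$; for such $\omega$ let $V_L(\omega)=-\min_{i,j} v_R\big(L(\omega)_{i,j}\big)$. Put $$E(q,d)=\sum_{v=1}^{\infty}\big[1-(1-q^{-v})^d\big],$$ which is a convergent series. Then $V_L$ is integrable and $$E(q,d)-\frac1{q-1}\;\le\;\mathbb{E}[V_L]\;\le\;E(q,d),$$ and the first inequality is strict whenever $d\ge 3$. Moreover $$\big|E(q,d)-\log_q d\big|\le\frac1{\log 2},$$ and $\big|E(q,d)-\log_q d\big|\le 1$ if $q\ge 3$. -/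

import Mathlib

namespace LUStat

noncomputable section

/-- The normalized (additive) valuation `v_R`, extended to the fraction field `K` of a discrete
valuation ring `R`; it takes the value `⊤` at `0` and the value `1` at a uniformizer. Mathlib's
valuation of `K` at the maximal ideal of `R` is multiplicative: it is `exp (-v_R x)` at `x ≠ 0`. -/
def valK (R : Type*) [CommRing R] [IsDomain R] [IsDiscreteValuationRing R]
    {K : Type*} [Field K] [Algebra R K] [IsFractionRing R K] (x : K) : WithTop ℤ :=
  open Classical in
  if x = 0 then ⊤
  else ((-WithZero.log ((IsDiscreteValuationRing.maximalIdeal R).valuation K x) : ℤ) : WithTop ℤ)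

/-- `M = L * U` with `L` unit lower triangular and `U` upper triangular. -/
structure IsLU {K : Type*} [Field K] {d : ℕ} (M L U : Matrix (Fin d) (Fin d) K) : Prop where
  diag_eq_one : ∀ i, L i i = 1
  lower : ∀ i j, i < j → L i j = 0
  upper : ∀ i j, j < i → U i j = 0
  eq_mul : M = L * U

/-- `M` has exactly one LU decomposition. -/
def HasUniqueLU {K : Type*} [Field K] {d : ℕ} (M : Matrix (Fin d) (Fin d) K) : Prop :=
  ∃! p : Matrix (Fin d) (Fin d) K × Matrix (Fin d) (Fin d) K, IsLU M p.1 p.2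

/-- The `L`-part of the LU decomposition of `M`, where the latter exists and is unique
(and the identity matrix elsewhere). -/
def luL {K : Type*} [Field K] {d : ℕ} (M : Matrix (Fin d) (Fin d) K) :
    Matrix (Fin d) (Fin d) K :=
  open Classical in
  if h : HasUniqueLU M then h.choose.1 else 1

/-- `V_L(ω)`: the opposite of the smallest valuation of an entry of `L(ω)`. The minimum is finite
for `0 < d`, since the diagonal entries of `L(ω)` are equal to `1`. -/
def VL {R : Type*} [CommRing R] [IsDomain R] [IsDiscreteValuationRing R]
    (K : Type*) [Field K] [Algebra R K] [IsFractionRing R K] {d : ℕ}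
    (ω : Matrix (Fin d) (Fin d) R) : ℤ :=
  -((Finset.univ : Finset (Fin d × Fin d)).inf
      fun p => valK R (luL (ω.map (algebraMap R K)) p.1 p.2)).untopD 0

/-- The `v`-th term `1 - (1 - q ^ (-v)) ^ d` of the series `E(q, d)`. -/
def Eterm (q d v : ℕ) : ℝ := 1 - (1 - ((q : ℝ) ^ v)⁻¹) ^ d

/-- `E(q, d) = ∑_{v ≥ 1} (1 - (1 - q ^ (-v)) ^ d)`. -/
def Eqd (q d : ℕ) : ℝ := ∑' v : ℕ, Eterm q d (v + 1)

end

end LUStat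

/-!
Write `m k i` for the minor of `ω` on the columns `0, …, k` and the rows `0, …, k - 1, i`. When the
leading principal minors `m k k` do not vanish, which is the case almost everywhere, there is exactly
one LU decomposition, and `L i k = m k i / m k k` for `k ≤ i` (`minor_of_isLU`, `exists_isLU`). Thus
`V_L ≥ v` means that `ϖ ^ v * m k i` divides `m k k` for some `k ≤ i`, where `ϖ` is a uniformizer
(`le_VL_iff`).

The exact law of `V_L` comes from symmetry. Left multiplication by a matrix `g = diag(1, g')`, with
an identity block of size `k` and `g'` invertible over `R`, preserves the Haar measure, acts linearly
through `g'` on the vector `(m k i)_{i ≥ k}` (`minor_mul`), and does not change the events attached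
to the columns before the `k`-th one (`mul_mem_tailSet_iff`). As these matrices act transitively on
primitive vectors, within any event that depends on the previous columns only in this invariant way
the primitive part of `(m k i)_{i ≥ k}`, reduced modulo `𝔪 ^ v`, is uniformly distributed on the
primitive vectors of length `n = d - k` over `R / 𝔪 ^ v`. Counting those whose first coordinate
vanishes gives the conditional probability `a_n q ^ (-v)` with `a_n = (q ^ n - q) / (q ^ n - 1)`
(`measureReal_inter_tailSet`, `ncard_primVec_zero`), hence
`P (V_L < v) = ∏_{n = 1}^{d} (1 - a_n q ^ (-v))` (`measureReal_iInter_compl_tailSet`), and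
`E [V_L] = ∑_{v ≥ 1} P (V_L ≥ v)`.

The upper bound follows from `a_n ≤ 1`. For the lower bound, `a_1 = 0` and `a_n ≥ a_2 = q / (q + 1)`
for `n ≥ 2`, strictly for `n ≥ 3`; what remains is that the series of
`1 - (1 - a_2 q ^ (-v)) ^ (d - 1)` is at least `E(q, d) - 1 / (q - 1)`
(`Eqd_succ_sub_le_tsum`), an equality for `d ≤ 2`, which is a telescoping form of Jensen's inequality.

Finally, comparing the series `E(q, d)` with the integral of its decreasing general term gives
`H_d - log q ≤ E(q, d) log q ≤ H_d`, with `H_d` the harmonic number (`harmonic_le_Eqd_mul_log`).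
-/

namespace LUStat

/-! ### The series `E(q, d)` -/

open Filter Topology

lemma Eterm_nonneg {q : ℕ} (hq : 2 ≤ q) (d v : ℕ) : 0 ≤ Eterm q d v := by
  have hq' : (1 : ℝ) ≤ (q : ℝ) ^ v := one_le_pow₀ (by exact_mod_cast (by omega : 1 ≤ q))
  have h1 : ((q : ℝ) ^ v)⁻¹ ≤ 1 := inv_le_one_of_one_le₀ hq'
  have h0 : 0 ≤ ((q : ℝ) ^ v)⁻¹ := by positivity
  exact sub_nonneg.2 (pow_le_one₀ (by linarith) (by linarith))

/-- Bernoulli's inequality, in the form used to bound tails of series. -/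
lemma one_sub_one_sub_pow_le {x : ℝ} (hx : x ≤ 2) (n : ℕ) : 1 - (1 - x) ^ n ≤ n * x := by
  have := one_add_mul_le_pow (a := -x) (by linarith) n
  rw [← sub_eq_add_neg] at this
  linarith

lemma summable_inv_pow_succ {q : ℕ} (hq : 2 ≤ q) :
    Summable fun v : ℕ => ((q : ℝ) ^ (v + 1))⁻¹ := by
  have h1 : ((q : ℝ))⁻¹ < 1 := inv_lt_one_of_one_lt₀ (by exact_mod_cast (by omega : 1 < q))
  have := (summable_geometric_of_lt_one (by positivity) h1).mul_left ((q : ℝ)⁻¹)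
  refine this.congr fun v => ?_
  rw [pow_succ, mul_inv, inv_pow, mul_comm]

lemma tsum_inv_pow_succ {q : ℕ} (hq : 2 ≤ q) :
    ∑' v : ℕ, ((q : ℝ) ^ (v + 1))⁻¹ = 1 / ((q : ℝ) - 1) := by
  have hq' : (2 : ℝ) ≤ q := by exact_mod_cast hq
  have h1 : ((q : ℝ))⁻¹ < 1 := inv_lt_one_of_one_lt₀ (by linarith)
  have h2 : ∀ v : ℕ, ((q : ℝ) ^ (v + 1))⁻¹ = (q : ℝ)⁻¹ * ((q : ℝ)⁻¹) ^ v := fun v => by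
    rw [pow_succ, mul_inv, inv_pow, mul_comm]
  rw [tsum_congr h2, tsum_mul_left, tsum_geometric_of_lt_one (by positivity) h1]
  have : (q : ℝ) - 1 ≠ 0 := by linarith
  field_simp

lemma summable_one_sub_pow {q : ℕ} (hq : 2 ≤ q) {a : ℝ} (ha0 : 0 ≤ a) (ha1 : a ≤ 1) (n : ℕ) :
    Summable fun v : ℕ => 1 - (1 - a * ((q : ℝ) ^ (v + 1))⁻¹) ^ n := by
  have hx1 (v : ℕ) : a * ((q : ℝ) ^ (v + 1))⁻¹ ≤ 1 := by
    have hq' : (1 : ℝ) ≤ (q : ℝ) ^ (v + 1) :=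
      one_le_pow₀ (by exact_mod_cast (by omega : 1 ≤ q))
    exact mul_le_one₀ ha1 (by positivity) (inv_le_one_of_one_le₀ hq')
  have hx0 (v : ℕ) : 0 ≤ a * ((q : ℝ) ^ (v + 1))⁻¹ := by positivity
  refine Summable.of_nonneg_of_le (fun v => ?_) (fun v => ?_)
    (((summable_inv_pow_succ hq).mul_left a).mul_left (n : ℝ))
  · exact sub_nonneg.2 (pow_le_one₀ (by linarith [hx1 v]) (by linarith [hx0 v]))
  · exact one_sub_one_sub_pow_le (by linarith [hx1 v]) n

lemma summable_Eterm {q : ℕ} (hq : 2 ≤ q) (d : ℕ) :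
    Summable fun v : ℕ => Eterm q d (v + 1) := by
  simpa [Eterm] using summable_one_sub_pow hq zero_le_one le_rfl d

/-- Two-point Jensen inequality: `1 - x / (1 + r)` is the mean of `1 - x` and
`1 - r x / (1 + r)` with weights `1 - r` and `r`. -/
lemma one_sub_div_pow_le {r x : ℝ} (hr0 : 0 ≤ r) (hr1 : r ≤ 1) (hx1 : x ≤ 1)
    (n : ℕ) :
    (1 - x / (1 + r)) ^ n ≤ (1 - r) * (1 - x) ^ n + r * (1 - r * x / (1 + r)) ^ n := by
  have hmem : r * x / (1 + r) ≤ 1 := by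
    rw [div_le_one (by linarith)]
    nlinarith
  have h := (convexOn_pow (𝕜 := ℝ) n).2 (x := 1 - x) (y := 1 - r * x / (1 + r))
    (by simpa using hx1) (by simpa using hmem) (sub_nonneg.2 hr1) hr0 (by ring)
  simp only [smul_eq_mul] at h
  have hmean : 1 - x / (1 + r) = (1 - r) * (1 - x) + r * (1 - r * x / (1 + r)) := by
    field_simp
    ring
  rwa [hmean]

/-- A lower bound for the series obtained from a product of `n` equal factors
`1 - q / (q + 1) * q ^ (-v)`. The two-point Jensen inequality is summed with the weights
`1 - q ^ (-v)`, for which it telescopes. -/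
lemma Eqd_succ_sub_le_tsum {q : ℕ} (hq : 2 ≤ q) (n : ℕ) :
    Eqd q (n + 1) - 1 / ((q : ℝ) - 1) ≤
      ∑' v : ℕ, (1 - (1 - (q : ℝ) / (q + 1) * ((q : ℝ) ^ (v + 1))⁻¹) ^ n) := by
  have hq' : (2 : ℝ) ≤ q := by exact_mod_cast hq
  set r : ℝ := (q : ℝ)⁻¹ with hr
  have hr0 : 0 < r := by positivity
  have hr1 : r < 1 := inv_lt_one_of_one_lt₀ (by linarith)
  have ha : (q : ℝ) / (q + 1) = 1 / (1 + r) := by rw [hr]; field_simp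
  have hpow (v : ℕ) : ((q : ℝ) ^ v)⁻¹ = r ^ v := by rw [hr, inv_pow]
  set ψ : ℕ → ℝ := fun v => 1 - (1 - (q : ℝ) / (q + 1) * ((q : ℝ) ^ (v + 1))⁻¹) ^ n with hψ
  have hψs : Summable ψ := by
    refine summable_one_sub_pow hq (by positivity) ?_ n
    rw [div_le_one (by positivity)]; linarith
  have hψ' (v : ℕ) : ψ v = 1 - (1 - r ^ (v + 1) / (1 + r)) ^ n := by
    simp only [hψ, ha, hpow]; congr 3; ring
  have hxv (v : ℕ) : r ^ (v + 1) ≤ 1 := pow_le_one₀ hr0.le hr1.le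
  set e : ℕ → ℝ := fun v => Eterm q (n + 1) (v + 1) - ((q : ℝ) ^ (v + 1))⁻¹ with he
  have hes : Summable e := (summable_Eterm hq (n + 1)).sub (summable_inv_pow_succ hq)
  have hetsum : ∑' v, e v = Eqd q (n + 1) - 1 / ((q : ℝ) - 1) := by
    rw [Eqd, ← tsum_inv_pow_succ hq]
    exact (summable_Eterm hq (n + 1)).tsum_sub (summable_inv_pow_succ hq)
  have he' (v : ℕ) : e v = (1 - r ^ (v + 1)) * (1 - (1 - r ^ (v + 1)) ^ n) := by
    simp only [he, Eterm, hpow]; ring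
  set f : ℕ → ℝ := fun v => (r - r ^ (v + 1)) * ψ v with hf
  have hψ0 (v : ℕ) : 0 ≤ ψ v := by
    rw [hψ']
    have h1 : r ^ (v + 1) / (1 + r) ≤ 1 := by
      rw [div_le_one (by linarith)]; linarith [hxv v]
    have h0 : 0 ≤ r ^ (v + 1) / (1 + r) := by positivity
    exact sub_nonneg.2 (pow_le_one₀ (by linarith) (by linarith))
  have hfs : Summable f := by
    refine Summable.of_nonneg_of_le (fun v => ?_) (fun v => ?_) hψs
    · refine mul_nonneg (sub_nonneg.2 ?_) (hψ0 v)
      calc r ^ (v + 1) = r ^ v * r := pow_succ r v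
        _ ≤ 1 * r := by gcongr; exact pow_le_one₀ hr0.le hr1.le
        _ = r := one_mul r
    · refine mul_le_of_le_one_left (hψ0 v) ?_
      have : 0 ≤ r ^ (v + 1) := by positivity
      linarith
  have hf0 : f 0 = 0 := by simp [hf]
  have hfshift : ∑' v, f v = ∑' v, f (v + 1) := by
    rw [hfs.tsum_eq_zero_add, hf0, zero_add]
  have hfs' : Summable fun v => f (v + 1) := (summable_nat_add_iff 1).2 hfs
  have key (v : ℕ) : (1 - r) * e v + f (v + 1) ≤ (1 - r) * ψ v + f v := by
    have hj := one_sub_div_pow_le hr0.le hr1.le (x := r ^ (v + 1)) (hxv v) n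
    have h3 : r * r ^ (v + 1) = r ^ (v + 1 + 1) := by ring
    rw [h3] at hj
    have h1 : 0 ≤ 1 - r ^ (v + 1) := sub_nonneg.2 (hxv v)
    have h2 : (1 - r) * (1 - (1 - r ^ (v + 1)) ^ n) + r * ψ (v + 1) ≤ ψ v := by
      rw [hψ' v, hψ' (v + 1)]; linarith
    have h4 := mul_le_mul_of_nonneg_left h2 h1
    have h5 : f (v + 1) = (1 - r ^ (v + 1)) * (r * ψ (v + 1)) := by
      simp only [hf]; ring
    rw [he' v, h5]
    simp only [hf]
    linarith
  have hsum := Summable.tsum_le_tsum key ((hes.mul_left (1 - r)).add hfs')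
    ((hψs.mul_left (1 - r)).add hfs)
  rw [(hes.mul_left (1 - r)).tsum_add hfs', (hψs.mul_left (1 - r)).tsum_add hfs, tsum_mul_left,
    tsum_mul_left, hfshift, hetsum] at hsum
  have : 0 < 1 - r := by linarith
  exact le_of_mul_le_mul_left (by linarith) this

/-- An antiderivative of `(1 - (1 - y) ^ d) / y`; its value at `1` is the `d`-th harmonic
number. -/
noncomputable def harmonicPoly (d : ℕ) (y : ℝ) : ℝ :=
  ∑ k ∈ Finset.range d, (1 - (1 - y) ^ (k + 1)) / ((k : ℝ) + 1)

lemma hasDerivAt_harmonicPoly (d : ℕ) (y : ℝ) :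
    HasDerivAt (harmonicPoly d) (∑ k ∈ Finset.range d, (1 - y) ^ k) y := by
  unfold harmonicPoly
  refine HasDerivAt.fun_sum fun k _ => ?_
  have h := ((((hasDerivAt_id y).const_sub 1).pow (k + 1)).const_sub 1).div_const ((k : ℝ) + 1)
  refine h.congr_deriv ?_
  have : (k : ℝ) + 1 ≠ 0 := by positivity
  simp only [id, Nat.add_sub_cancel, Nat.cast_add, Nat.cast_one]
  field_simp

/-- Comparison of the series `E(q, d)` with the integral of its general term, which is a
harmonic number divided by `log q`. -/
lemma harmonic_le_Eqd_mul_log {q d : ℕ} (hq : 2 ≤ q) :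
    (harmonic d : ℝ) - Real.log q ≤ Eqd q d * Real.log q ∧
      Eqd q d * Real.log q ≤ harmonic d := by
  have hq' : (2 : ℝ) ≤ q := by exact_mod_cast hq
  set L := Real.log q with hL
  have hL0 : 0 < L := Real.log_pos (by linarith)
  set h : ℝ → ℝ := fun t => 1 - (1 - Real.exp (-t * L)) ^ d with hh
  set g : ℝ → ℝ := fun t => harmonicPoly d (Real.exp (-t * L)) with hg
  have hexp (v : ℕ) : Real.exp (-(v : ℝ) * L) = ((q : ℝ) ^ v)⁻¹ := by
    rw [neg_mul, Real.exp_neg, Real.exp_nat_mul, hL, Real.exp_log (by linarith)]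
  have hhv (v : ℕ) : h v = Eterm q d v := by simp only [hh, hexp, Eterm]
  have hderiv (t : ℝ) : HasDerivAt g (-L * h t) t := by
    have h1 : HasDerivAt (fun t : ℝ => Real.exp (-t * L)) (Real.exp (-t * L) * (-1 * L)) t :=
      (((hasDerivAt_id t).neg).mul_const L).exp
    have h2 := (hasDerivAt_harmonicPoly d (Real.exp (-t * L))).comp t h1
    refine h2.congr_deriv ?_
    have h3 := mul_neg_geom_sum (1 - Real.exp (-t * L)) d
    simp only [hh, ← h3]
    ring
  have hanti {s t : ℝ} (hs : 0 ≤ s) (hst : s ≤ t) : h t ≤ h s := by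
    have h1 : Real.exp (-t * L) ≤ Real.exp (-s * L) := Real.exp_le_exp.2 (by nlinarith)
    have h2 : Real.exp (-s * L) ≤ 1 := Real.exp_le_one_iff.2 (by nlinarith)
    simp only [hh]
    gcongr
  have hmvt (v : ℕ) : L * Eterm q d (v + 1) ≤ g v - g (v + 1 : ℕ) ∧
      g v - g (v + 1 : ℕ) ≤ L * Eterm q d v := by
    obtain ⟨c, hc, hceq⟩ := exists_hasDerivAt_eq_slope g (fun t => -L * h t)
      (show (v : ℝ) < (v + 1 : ℕ) by push_cast; linarith)
      (fun t _ => (hderiv t).continuousAt.continuousWithinAt) (fun t _ => hderiv t)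
    have hw : ((v + 1 : ℕ) : ℝ) - v = 1 := by push_cast; ring
    rw [hw, div_one] at hceq
    have hv0 : (0 : ℝ) ≤ v := Nat.cast_nonneg v
    have h1 := hanti (hv0.trans hc.1.le) hc.2.le
    have h2 := hanti hv0 hc.1.le
    rw [hhv] at h1 h2
    constructor <;> nlinarith
  have hg0 : g 0 = harmonic d := by
    simp [hg, harmonicPoly, harmonic]
  have hglim : Tendsto (fun v : ℕ => g v) atTop (𝓝 0) := by
    have h1 : Tendsto (fun v : ℕ => Real.exp (-(v : ℝ) * L)) atTop (𝓝 0) := by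
      simp only [hexp]
      exact tendsto_inv_atTop_zero.comp (tendsto_pow_atTop_atTop_of_one_lt (by linarith))
    have h2 := (hasDerivAt_harmonicPoly d 0).continuousAt.tendsto.comp h1
    have h3 : harmonicPoly d 0 = 0 := by simp [harmonicPoly]
    rwa [h3] at h2
  have hs : HasSum (fun v : ℕ => g v - g (v + 1 : ℕ)) (harmonic d) := by
    rw [hasSum_iff_tendsto_nat_of_nonneg
      (fun v => (mul_nonneg hL0.le (Eterm_nonneg hq d _)).trans (hmvt v).1)]
    have h1 (n : ℕ) : ∑ i ∈ Finset.range n, (g i - g (i + 1 : ℕ)) = g 0 - g n := by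
      simpa using Finset.sum_range_sub' (fun i : ℕ => g i) n
    simp only [h1]
    simpa [hg0] using hglim.const_sub (g 0)
  have hE := summable_Eterm hq d
  have hE0 : Summable fun v : ℕ => Eterm q d v := (summable_nat_add_iff 1).1 hE
  have hE0sum : ∑' v : ℕ, Eterm q d v ≤ 1 + Eqd q d := by
    rw [hE0.tsum_eq_zero_add, Eqd]
    gcongr
    simp [Eterm]
  constructor
  · have := hs.summable.tsum_le_tsum (fun v => (hmvt v).2) (hE0.mul_left L)
    rw [hs.tsum_eq, tsum_mul_left] at this
    nlinarith
  · have := (hE.mul_left L).tsum_le_tsum (fun v => (hmvt v).1) hs.summable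
    rw [hs.tsum_eq, tsum_mul_left] at this
    rw [Eqd, mul_comm]
    exact this

lemma abs_Eqd_sub_logb_le {q d : ℕ} (hq : 2 ≤ q) (hd : 0 < d) :
    |Eqd q d - Real.logb q d| ≤ max 1 (1 / Real.log q) := by
  have hq' : (2 : ℝ) ≤ q := by exact_mod_cast hq
  have hL0 : 0 < Real.log q := Real.log_pos (by linarith)
  obtain ⟨h1, h2⟩ := harmonic_le_Eqd_mul_log (d := d) hq
  have h3 : Real.log d ≤ harmonic d := by
    refine le_trans (Real.log_le_log (by exact_mod_cast hd) ?_) (log_add_one_le_harmonic d)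
    push_cast; linarith
  have h4 := harmonic_le_one_add_log d
  have h5 : Real.logb q d * Real.log q = Real.log d := div_mul_cancel₀ _ hL0.ne'
  rw [abs_le]
  constructor
  · refine le_trans (neg_le_neg (le_max_left _ _)) ?_
    refine le_of_mul_le_mul_right ?_ hL0
    linarith
  · refine le_trans ?_ (le_max_right _ _)
    rw [le_div_iff₀ hL0]
    linarith

lemma abs_Eqd_sub_logb_le_inv_log_two {q d : ℕ} (hq : 2 ≤ q) (hd : 0 < d) :
    |Eqd q d - Real.logb q d| ≤ 1 / Real.log 2 := by
  have hq' : (2 : ℝ) ≤ q := by exact_mod_cast hq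
  refine (abs_Eqd_sub_logb_le hq hd).trans (max_le ?_ ?_)
  · rw [le_div_iff₀ (Real.log_pos (by norm_num)), one_mul]
    linarith [Real.log_two_lt_d9]
  · exact one_div_le_one_div_of_le (Real.log_pos (by norm_num))
      (Real.log_le_log (by norm_num) hq')

lemma abs_Eqd_sub_logb_le_one {q d : ℕ} (hq : 3 ≤ q) (hd : 0 < d) :
    |Eqd q d - Real.logb q d| ≤ 1 := by
  have hq' : (3 : ℝ) ≤ q := by exact_mod_cast hq
  refine (abs_Eqd_sub_logb_le (by omega) hd).trans (max_le le_rfl ?_)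
  have h1 : 1 ≤ Real.log q := by
    rw [Real.le_log_iff_exp_le (by linarith)]
    linarith [Real.exp_one_lt_d9]
  exact div_le_one_of_le₀ h1 (by linarith)

end LUStat

namespace LUStat

/-! ### LU decompositions and minors -/

open Matrix

/-- The minor of `M` on the columns `0, …, k` and the rows `0, …, k - 1, i`. The `k`-th row of the
leading block of size `k + 1` is replaced by the `i`-th row of `M`. -/
def minor {A : Type*} [CommRing A] {d : ℕ} (k i : Fin d) (M : Matrix (Fin d) (Fin d) A) : A :=
  ((M.submatrix (fun a : {a : Fin d // a ≤ k} => (a : Fin d))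
    (fun a : {a : Fin d // a ≤ k} => (a : Fin d))).updateRow ⟨k, le_rfl⟩ (fun b => M i b)).det

lemma minor_self {A : Type*} [CommRing A] {d : ℕ} (k : Fin d) (M : Matrix (Fin d) (Fin d) A) :
    minor k k M = (M.submatrix (fun a : {a : Fin d // a ≤ k} => (a : Fin d))
      (fun a : {a : Fin d // a ≤ k} => (a : Fin d))).det := by
  rw [minor]
  exact congrArg det (updateRow_eq_self
    (M.submatrix (fun a : {a : Fin d // a ≤ k} => (a : Fin d))
      (fun a : {a : Fin d // a ≤ k} => (a : Fin d))) ⟨k, le_rfl⟩)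

lemma minor_map {A B : Type*} [CommRing A] [CommRing B] (f : A →+* B) {d : ℕ} (k i : Fin d)
    (M : Matrix (Fin d) (Fin d) A) : minor k i (M.map f) = f (minor k i M) := by
  rw [minor, minor, RingHom.map_det]
  congr 1
  ext a b
  by_cases h : a = ⟨k, le_rfl⟩ <;> simp [updateRow_apply, h]

lemma sum_eq_sum_subtype_le {A : Type*} [AddCommMonoid A] {d : ℕ} (k : Fin d) {f : Fin d → A}
    (hf : ∀ c, k < c → f c = 0) : ∑ c, f c = ∑ c : {a : Fin d // a ≤ k}, f c := by
  rw [← Finset.sum_subtype (Finset.univ.filter (· ≤ k)) (by simp), Finset.sum_filter]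
  refine Finset.sum_congr rfl fun c _ => ?_
  split_ifs with hc
  · rfl
  · exact hf c (not_le.1 hc)

/-- By multiplicativity of determinants, the minors of `L * U` on the first columns are those of
the first columns of `L`, up to a factor that depends on `U` only. -/
lemma minor_of_isLU {K : Type*} [Field K] {d : ℕ} {M L U : Matrix (Fin d) (Fin d) K}
    (h : IsLU M L U) (k i : Fin d) : minor k i M = L i k * minor k k M := by
  have key (i : Fin d) : minor k i M = L i k * ∏ a : {a : Fin d // a ≤ k}, U a a := by
    set s : {a : Fin d // a ≤ k} → Fin d := fun a => a with hs
    set k' : {a : Fin d // a ≤ k} := ⟨k, le_rfl⟩ with hk'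
    have hrow (x : Fin d) (b : {a : Fin d // a ≤ k}) :
        M x b = ∑ c : {a : Fin d // a ≤ k}, L x c * U c b := by
      rw [h.eq_mul, mul_apply]
      exact sum_eq_sum_subtype_le k fun c hc => by
        rw [h.upper c b (lt_of_le_of_lt b.2 hc), mul_zero]
    have hmul : (M.submatrix s s).updateRow k' (fun b => M i b) =
        ((L.submatrix s s).updateRow k' (fun b => L i b)) * U.submatrix s s := by
      ext a b
      by_cases ha : a = k'
      · simp [ha, mul_apply, hrow, hs]
      · simp [ha, mul_apply, hrow, updateRow_apply, hs]
    have hL : ((L.submatrix s s).updateRow k' (fun b => L i b)).det = L i k := by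
      rw [det_of_isLowerTriangular]
      · rw [Finset.prod_eq_single k']
        · simp [hk']
        · intro b _ hb
          simp [updateRow_apply, hb, h.diag_eq_one, hs]
        · simp
      · intro a b hab
        have hab' : a < b := hab
        have hak : a ≠ k' := fun e => (lt_of_lt_of_le hab' (show b ≤ k' from b.2)).ne e
        simpa [updateRow_apply, hak, hs] using h.lower a b hab'
    have hU : (U.submatrix s s).det = ∏ a : {a : Fin d // a ≤ k}, U a a := by
      rw [det_of_isUpperTriangular]
      · rfl
      · intro a b hab
        exact h.upper a b hab
    rw [minor, hmul, det_mul, hL, hU]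
  rw [key i, key k, h.diag_eq_one, one_mul]

/-- If the leading principal minors of `M` do not vanish, the vectors `x` supported on
`0, …, k` with `(M x)_i = δ_{i k}` for `i ≤ k` are the columns of an upper triangular `V` with
`M V` unit lower triangular. -/
lemma exists_isLU {K : Type*} [Field K] {d : ℕ} {M : Matrix (Fin d) (Fin d) K}
    (h : ∀ k, minor k k M ≠ 0) : ∃ L U, IsLU M L U := by
  let B : (k : Fin d) → Matrix {a : Fin d // a ≤ k} {a : Fin d // a ≤ k} K :=
    fun k => M.submatrix (fun a => (a : Fin d)) (fun a => (a : Fin d))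
  have hB (k : Fin d) : IsUnit (B k).det := by
    rw [isUnit_iff_ne_zero, ← minor_self]
    exact h k
  let V : Matrix (Fin d) (Fin d) K :=
    of fun b k => if hb : b ≤ k then (B k)⁻¹ ⟨b, hb⟩ ⟨k, le_rfl⟩ else 0
  have hV : V.IsUpperTriangular := by
    intro b k hbk
    have hbk' : k < b := hbk
    simp [V, not_le.2 hbk']
  have hMV (i k : Fin d) (hik : i ≤ k) : (M * V) i k = if i = k then 1 else 0 := by
    have h1 : (B k * (B k)⁻¹) ⟨i, hik⟩ ⟨k, le_rfl⟩ = if i = k then 1 else 0 := by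
      rw [mul_nonsing_inv _ (hB k), one_apply]
      simp
    rw [← h1, mul_apply, mul_apply, sum_eq_sum_subtype_le k]
    · refine Finset.sum_congr rfl fun b _ => ?_
      have hb : (b : Fin d) ≤ k := b.2
      simp [B, V, hb]
    · intro c hc
      simp [V, not_le.2 hc]
  have hdet : (M * V).det = 1 := by
    rw [det_of_isLowerTriangular]
    · exact Finset.prod_eq_one fun i _ => by simp [hMV i i le_rfl]
    · intro i k hik
      have hik' : i < k := hik
      rw [hMV i k hik'.le, if_neg hik'.ne]
  have hVdet : IsUnit V.det := by
    rw [isUnit_iff_ne_zero]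
    intro h0
    rw [det_mul, h0, mul_zero] at hdet
    exact zero_ne_one hdet
  let _ := invertibleOfIsUnitDet V hVdet
  refine ⟨M * V, V⁻¹, fun i => by simp [hMV i i le_rfl], fun i j hij => ?_, fun i j hij => ?_, ?_⟩
  · rw [hMV i j hij.le, if_neg hij.ne]
  · exact blockTriangular_inv_of_blockTriangular hV hij
  · rw [mul_nonsing_inv_cancel_right _ _ hVdet]

lemma hasUniqueLU_of_minor_ne_zero {K : Type*} [Field K] {d : ℕ} {M : Matrix (Fin d) (Fin d) K}
    (h : ∀ k, minor k k M ≠ 0) : HasUniqueLU M := by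
  obtain ⟨L, U, hLU⟩ := exists_isLU h
  refine ⟨(L, U), hLU, ?_⟩
  rintro ⟨L', U'⟩ hLU'
  have hL : L' = L := by
    ext i k
    exact mul_right_cancel₀ (h k) ((minor_of_isLU hLU' k i).symm.trans (minor_of_isLU hLU k i))
  have hdet : L.det = 1 := by
    rw [det_of_isLowerTriangular]
    · exact Finset.prod_eq_one fun i _ => hLU.diag_eq_one i
    · intro i k hik
      exact hLU.lower i k hik
  have hU : U' = U := by
    have h1 : L * U' = L * U := by rw [← hLU.eq_mul, ← hL]; exact hLU'.eq_mul.symm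
    have h2 : IsUnit L.det := by rw [hdet]; exact isUnit_one
    rw [← nonsing_inv_mul_cancel_left L U' h2, h1, nonsing_inv_mul_cancel_left L U h2]
  rw [hL, hU]

lemma luL_eq_div {K : Type*} [Field K] {d : ℕ} {M : Matrix (Fin d) (Fin d) K}
    (h : ∀ k, minor k k M ≠ 0) (i k : Fin d) : luL M i k = minor k i M / minor k k M := by
  have hM := hasUniqueLU_of_minor_ne_zero h
  have h1 : IsLU M hM.choose.1 hM.choose.2 := hM.choose_spec.1
  rw [luL, dif_pos hM, eq_div_iff (h k), ← minor_of_isLU h1]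

lemma luL_self {K : Type*} [Field K] {d : ℕ} (M : Matrix (Fin d) (Fin d) K) (i : Fin d) :
    luL M i i = 1 := by
  rw [luL]
  split_ifs with hM
  · have h1 : IsLU M hM.choose.1 hM.choose.2 := hM.choose_spec.1
    exact h1.diag_eq_one i
  · simp

lemma minor_eq_zero_of_lt {A : Type*} [CommRing A] {d : ℕ} {k i : Fin d} (h : i < k)
    (M : Matrix (Fin d) (Fin d) A) : minor k i M = 0 := by
  refine det_zero_of_row_eq (i := ⟨i, h.le⟩) (j := ⟨k, le_rfl⟩) ?_ ?_
  · simpa using h.ne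
  · ext b
    have : (⟨i, h.le⟩ : {a : Fin d // a ≤ k}) ≠ ⟨k, le_rfl⟩ := by simpa using h.ne
    simp [updateRow_apply, this]

section Valuation

variable {R : Type*} [CommRing R] [IsDomain R] [IsDiscreteValuationRing R]
  {K : Type*} [Field K] [Algebra R K] [IsFractionRing R K]

lemma valuation_algebraMap_irreducible {ϖ : R} (hϖ : Irreducible ϖ) :
    (IsDiscreteValuationRing.maximalIdeal R).valuation K (algebraMap R K ϖ) =
      WithZero.exp (-1 : ℤ) := by
  rw [IsDedekindDomain.HeightOneSpectrum.valuation_of_algebraMap]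
  exact IsDedekindDomain.HeightOneSpectrum.intValuation_singleton _ hϖ.ne_zero hϖ.maximalIdeal_eq

lemma valuation_algebraMap_le_iff_dvd {a b : R} (ha : a ≠ 0) :
    (IsDiscreteValuationRing.maximalIdeal R).valuation K (algebraMap R K b) ≤
      (IsDiscreteValuationRing.maximalIdeal R).valuation K (algebraMap R K a) ↔ a ∣ b := by
  have ha' : algebraMap R K a ≠ 0 := by simpa using ha
  constructor
  · intro h
    have h1 : (IsDiscreteValuationRing.maximalIdeal R).valuation K
        (algebraMap R K b / algebraMap R K a) ≤ 1 := by
      rw [map_div₀]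
      exact div_le_one_of_le₀ h zero_le
    obtain ⟨c, hc⟩ := IsDiscreteValuationRing.exists_lift_of_le_one h1
    refine ⟨c, IsFractionRing.injective R K ?_⟩
    rw [map_mul, hc, mul_div_cancel₀ _ ha']
  · rintro ⟨c, rfl⟩
    rw [map_mul, map_mul]
    exact mul_le_of_le_one_right' (IsDedekindDomain.HeightOneSpectrum.valuation_le_one _ c)

lemma valK_div_le_neg_iff {ϖ : R} (hϖ : Irreducible ϖ) {a b : R} (hb : b ≠ 0) (n : ℕ) :
    valK R (algebraMap R K a / algebraMap R K b) ≤ ((-(n : ℤ) : ℤ) : WithTop ℤ) ↔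
      ϖ ^ n * a ∣ b := by
  by_cases ha : a = 0
  · simp [ha, valK, hb]
  have ha' : algebraMap R K a ≠ 0 := by simpa using ha
  have hb' : algebraMap R K b ≠ 0 := by simpa using hb
  have hne : algebraMap R K a / algebraMap R K b ≠ 0 := div_ne_zero ha' hb'
  have hv (x : K) (hx : x ≠ 0) : (IsDiscreteValuationRing.maximalIdeal R).valuation K x ≠ 0 :=
    (Valuation.ne_zero_iff _).2 hx
  rw [valK, if_neg hne, WithTop.coe_le_coe, neg_le_neg_iff, map_div₀,
    WithZero.log_div (hv _ ha') (hv _ hb'),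
    ← valuation_algebraMap_le_iff_dvd (K := K) (mul_ne_zero (pow_ne_zero _ hϖ.ne_zero) ha),
    map_mul, map_mul, map_pow, map_pow, valuation_algebraMap_irreducible hϖ,
    ← WithZero.log_le_log (hv _ hb') (by simp [hv _ ha']), WithZero.log_mul (by simp) (hv _ ha')]
  simp
  constructor <;> intro h <;> linarith

lemma VL_nonneg {d : ℕ} (hd : 0 < d) (ω : Matrix (Fin d) (Fin d) R) : 0 ≤ VL K ω := by
  have h1 : ((Finset.univ : Finset (Fin d × Fin d)).inf
      fun p => valK R (luL (ω.map (algebraMap R K)) p.1 p.2)) ≤ ((0 : ℤ) : WithTop ℤ) := by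
    refine (Finset.inf_le (Finset.mem_univ ((⟨0, hd⟩, ⟨0, hd⟩) : Fin d × Fin d))).trans ?_
    simp [luL_self, valK]
  rw [VL, neg_nonneg]
  exact WithTop.untopD_le h1

lemma le_VL_iff {ϖ : R} (hϖ : Irreducible ϖ) {d : ℕ} (hd : 0 < d) {ω : Matrix (Fin d) (Fin d) R}
    (h : ∀ k, minor k k ω ≠ 0) (n : ℕ) :
    (n : ℤ) ≤ VL K ω ↔ ∃ k i, k ≤ i ∧ ϖ ^ n * minor k i ω ∣ minor k k ω := by
  have hmap (k i : Fin d) : minor k i (ω.map (algebraMap R K)) = algebraMap R K (minor k i ω) :=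
    minor_map (algebraMap R K) k i ω
  have hK (k : Fin d) : minor k k (ω.map (algebraMap R K)) ≠ 0 := by
    rw [hmap]; simpa using h k
  set m := (Finset.univ : Finset (Fin d × Fin d)).inf
      fun p => valK R (luL (ω.map (algebraMap R K)) p.1 p.2) with hm
  have h1 : m ≤ ((0 : ℤ) : WithTop ℤ) := by
    refine (Finset.inf_le (Finset.mem_univ ((⟨0, hd⟩, ⟨0, hd⟩) : Fin d × Fin d))).trans ?_
    simp [luL_self, valK]
  have h2 : (n : ℤ) ≤ VL K ω ↔ m ≤ ((-(n : ℤ) : ℤ) : WithTop ℤ) := by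
    rw [VL, ← hm]
    obtain ⟨z, hz⟩ := WithTop.ne_top_iff_exists.1 (ne_top_of_le_ne_top WithTop.coe_ne_top h1)
    rw [← hz, WithTop.untopD_coe, WithTop.coe_le_coe]
    exact le_neg
  rw [h2, hm, Finset.inf_le_iff (WithTop.coe_lt_top _)]
  constructor
  · rintro ⟨⟨i, k⟩, -, hik⟩
    rw [luL_eq_div hK, hmap, hmap, valK_div_le_neg_iff hϖ (h k)] at hik
    refine ⟨k, i, not_lt.1 fun hlt => h k ?_, hik⟩
    rw [minor_eq_zero_of_lt hlt, mul_zero, zero_dvd_iff] at hik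
    exact hik
  · rintro ⟨k, i, -, hik⟩
    refine ⟨(i, k), Finset.mem_univ _, ?_⟩
    rw [luL_eq_div hK, hmap, hmap, valK_div_le_neg_iff hϖ (h k)]
    exact hik

end Valuation

end LUStat

namespace LUStat

/-! ### Primitive vectors over a discrete valuation ring -/

section PrimitiveVectors

variable {R : Type*} [CommRing R] [IsDomain R] [IsDiscreteValuationRing R] {ϖ : R} {d : ℕ}

/-- The vectors `c` whose tail `(c i)_{i ≥ k}` is, up to a power of the uniformizer `ϖ`, congruent
modulo `ϖ ^ v` to the tail of `u`. -/
def primClass (ϖ : R) (k : Fin d) (v : ℕ) (u : Fin d → R) : Set (Fin d → R) :=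
  {c | ∃ e : ℕ, ∀ i, k ≤ i → ϖ ^ (e + v) ∣ c i - ϖ ^ e * u i}

lemma isUnit_of_dvd_sub (hϖ : Irreducible ϖ) {x y : R} (hx : IsUnit x) (h : ϖ ∣ y - x) :
    IsUnit y := by
  by_contra hy
  have hy' : ϖ ∣ y := by
    rw [← IsLocalRing.notMem_maximalIdeal, not_not, hϖ.maximalIdeal_eq,
      Ideal.mem_span_singleton] at hy
    exact hy
  exact hϖ.not_isUnit (isUnit_of_dvd_unit ((dvd_sub_right hy').1 h) hx)

/-- In a discrete valuation ring one coordinate of a vector divides all the others. -/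
lemma exists_forall_ge_dvd (k : Fin d) (c : Fin d → R) :
    ∃ j, k ≤ j ∧ ∀ i, k ≤ i → c j ∣ c i := by
  obtain ⟨j, hj, hmin⟩ := Finset.exists_min_image (Finset.univ.filter (k ≤ ·))
    (fun i => IsDiscreteValuationRing.addVal R (c i)) ⟨k, by simp⟩
  refine ⟨j, by simpa using hj, fun i hi => ?_⟩
  exact IsDiscreteValuationRing.addVal_le_iff_dvd.1 (hmin i (by simpa using hi))

lemma exists_eq_pow_mul_primitive (hϖ : Irreducible ϖ) {k : Fin d} {c : Fin d → R}
    (hc : ∃ i, k ≤ i ∧ c i ≠ 0) :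
    ∃ (e : ℕ) (w : Fin d → R), (∃ i, k ≤ i ∧ IsUnit (w i)) ∧ ∀ i, k ≤ i → c i = ϖ ^ e * w i := by
  obtain ⟨j, hj, hdvd⟩ := exists_forall_ge_dvd k c
  obtain ⟨i₀, hi₀, hne⟩ := hc
  have hcj : c j ≠ 0 := fun h => hne (zero_dvd_iff.1 (h ▸ hdvd i₀ hi₀))
  obtain ⟨e, u, hu⟩ := IsDiscreteValuationRing.eq_unit_mul_pow_irreducible hcj hϖ
  have h1 (i : Fin d) (hi : k ≤ i) : ∃ w, c i = ϖ ^ e * w :=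
    (Dvd.intro_left (u : R) hu.symm).trans (hdvd i hi)
  have h2 (i : Fin d) : ∃ w, k ≤ i → c i = ϖ ^ e * w := by
    by_cases hi : k ≤ i
    · obtain ⟨w, hw⟩ := h1 i hi
      exact ⟨w, fun _ => hw⟩
    · exact ⟨0, fun h => absurd h hi⟩
  choose w hw using h2
  refine ⟨e, w, ⟨j, hj, ?_⟩, hw⟩
  have : w j = u := by
    refine mul_left_cancel₀ (pow_ne_zero e hϖ.ne_zero) ?_
    rw [← hw j hj, hu, mul_comm]
  rw [this]
  exact u.isUnit

lemma exists_eq_of_mem_primClass (hϖ : Irreducible ϖ) {k : Fin d} {v : ℕ} (hv : v ≠ 0)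
    {u c : Fin d → R} (hu : ∃ i, k ≤ i ∧ IsUnit (u i)) (hc : c ∈ primClass ϖ k v u) :
    ∃ (e : ℕ) (w : Fin d → R), (∃ i, k ≤ i ∧ IsUnit (w i)) ∧
      ∀ i, k ≤ i → c i = ϖ ^ e * w i ∧ ϖ ^ v ∣ w i - u i := by
  obtain ⟨e, he⟩ := hc
  have h2 (i : Fin d) : ∃ w, k ≤ i → c i = ϖ ^ e * w ∧ ϖ ^ v ∣ w - u i := by
    by_cases hi : k ≤ i
    · obtain ⟨t, ht⟩ := he i hi
      refine ⟨u i + ϖ ^ v * t, fun _ => ⟨?_, t, by ring⟩⟩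
      rw [sub_eq_iff_eq_add.1 ht]
      ring
    · exact ⟨0, fun h => absurd h hi⟩
  choose w hw using h2
  obtain ⟨i, hi, hui⟩ := hu
  exact ⟨e, w, ⟨i, hi, isUnit_of_dvd_sub hϖ hui ((dvd_pow_self ϖ hv).trans (hw i hi).2)⟩, hw⟩

lemma exists_pow_mul_dvd_iff_of_mem_primClass (hϖ : Irreducible ϖ) {k : Fin d} {v : ℕ}
    (hv : v ≠ 0) {u c : Fin d → R} (hu : ∃ i, k ≤ i ∧ IsUnit (u i))
    (hc : c ∈ primClass ϖ k v u) : (∃ i, k ≤ i ∧ ϖ ^ v * c i ∣ c k) ↔ ϖ ^ v ∣ u k := by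
  obtain ⟨e, w, ⟨j, hj, hwj⟩, hw⟩ := exists_eq_of_mem_primClass hϖ hv hu hc
  have hk : ϖ ^ v ∣ u k ↔ ϖ ^ v ∣ w k := ((dvd_iff_dvd_of_dvd_sub (hw k le_rfl).2)).symm
  have hdvd (i : Fin d) (hi : k ≤ i) : ϖ ^ v * c i ∣ c k ↔ ϖ ^ v * w i ∣ w k := by
    rw [(hw i hi).1, (hw k le_rfl).1, mul_left_comm]
    exact mul_dvd_mul_iff_left (pow_ne_zero e hϖ.ne_zero)
  rw [hk]
  constructor
  · rintro ⟨i, hi, h⟩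
    exact (dvd_mul_right _ _).trans ((hdvd i hi).1 h)
  · intro h
    exact ⟨j, hj, (hdvd j hj).2 ((hwj.mul_right_dvd).2 h)⟩

lemma dvd_sub_of_mem_primClass (hϖ : Irreducible ϖ) {k : Fin d} {v : ℕ} (hv : v ≠ 0)
    {u u' c : Fin d → R} (hu : ∃ i, k ≤ i ∧ IsUnit (u i)) (hu' : ∃ i, k ≤ i ∧ IsUnit (u' i))
    (hc : c ∈ primClass ϖ k v u) (hc' : c ∈ primClass ϖ k v u') {i : Fin d} (hi : k ≤ i) :
    ϖ ^ v ∣ u i - u' i := by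
  obtain ⟨e, w, ⟨j, hj, hwj⟩, hw⟩ := exists_eq_of_mem_primClass hϖ hv hu hc
  obtain ⟨e', w', ⟨j', hj', hwj'⟩, hw'⟩ := exists_eq_of_mem_primClass hϖ hv hu' hc'
  have hle {e e' : ℕ} {a b : R} (ha : IsUnit a) (h : ϖ ^ e * a = ϖ ^ e' * b) : e' ≤ e := by
    have h1 : ϖ ^ e' ∣ ϖ ^ e := (ha.dvd_mul_right).1 (Dvd.intro b h.symm)
    exact (pow_dvd_pow_iff hϖ.ne_zero hϖ.not_isUnit).1 h1
  have hee : e = e' := le_antisymm (hle hwj' (((hw' j' hj').1).symm.trans (hw j' hj').1))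
    (hle hwj (((hw j hj).1).symm.trans (hw' j hj).1))
  subst hee
  have hww : w i = w' i := mul_left_cancel₀ (pow_ne_zero e hϖ.ne_zero)
    (((hw i hi).1).symm.trans (hw' i hi).1)
  have := dvd_sub (hw' i hi).2 (hw i hi).2
  rw [hww] at this
  simpa using this

end PrimitiveVectors

section Counting

variable {R : Type*} [CommRing R] [IsDomain R] [IsDiscreteValuationRing R] {ϖ : R} {d : ℕ}

/-- A lift to `R` of a vector modulo `𝔪 ^ v` indexed by `i ≥ k`, extended by `0` to `i < k`. -/
noncomputable def liftVec (k : Fin d) (v : ℕ)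
    (p : {i : Fin d // k ≤ i} → R ⧸ IsLocalRing.maximalIdeal R ^ v) : Fin d → R :=
  fun i => if h : k ≤ i then (p ⟨i, h⟩).out else 0

/-- The primitive vectors modulo `𝔪 ^ v` indexed by `i ≥ k`. -/
def primVec (R : Type*) [CommRing R] [IsDomain R] [IsDiscreteValuationRing R] (k : Fin d) (v : ℕ) :
    Set ({i : Fin d // k ≤ i} → R ⧸ IsLocalRing.maximalIdeal R ^ v) :=
  {p | ∃ i, IsUnit (p i).out}

lemma mk_eq_of_pow_dvd (hϖ : Irreducible ϖ) (v : ℕ) {x y : R} :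
    ϖ ^ v ∣ x - y ↔ Ideal.Quotient.mk (IsLocalRing.maximalIdeal R ^ v) x =
      Ideal.Quotient.mk (IsLocalRing.maximalIdeal R ^ v) y := by
  rw [Ideal.Quotient.eq, hϖ.maximalIdeal_eq, Ideal.span_singleton_pow, Ideal.mem_span_singleton]

lemma exists_mem_primClass_liftVec (hϖ : Irreducible ϖ) {k : Fin d} {v : ℕ} (hv : v ≠ 0)
    {c : Fin d → R} (hc : ∃ i, k ≤ i ∧ c i ≠ 0) :
    ∃ p ∈ primVec R k v, c ∈ primClass ϖ k v (liftVec k v p) := by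
  obtain ⟨e, w, ⟨j, hj, hwj⟩, hw⟩ := exists_eq_pow_mul_primitive hϖ hc
  let p : {i : Fin d // k ≤ i} → R ⧸ IsLocalRing.maximalIdeal R ^ v :=
    fun i => Ideal.Quotient.mk _ (w i)
  have hp (i : {i : Fin d // k ≤ i}) : ϖ ^ v ∣ w i - (p i).out := by
    rw [mk_eq_of_pow_dvd hϖ]
    exact (Ideal.Quotient.mk_out _).symm
  refine ⟨p, ⟨⟨j, hj⟩, isUnit_of_dvd_sub hϖ hwj ?_⟩, e, fun i hi => ?_⟩
  · exact (dvd_pow_self ϖ hv).trans ((dvd_sub_comm).1 (hp ⟨j, hj⟩))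
  · rw [hw i hi, ← mul_sub, pow_add, liftVec, dif_pos hi]
    exact mul_dvd_mul_left _ (hp ⟨i, hi⟩)

lemma exists_isUnit_liftVec {k : Fin d} {v : ℕ}
    {p : {i : Fin d // k ≤ i} → R ⧸ IsLocalRing.maximalIdeal R ^ v} (hp : p ∈ primVec R k v) :
    ∃ i, k ≤ i ∧ IsUnit (liftVec k v p i) := by
  obtain ⟨⟨i, hi⟩, hui⟩ := hp
  exact ⟨i, hi, by rwa [liftVec, dif_pos hi]⟩

lemma pow_dvd_liftVec_iff (hϖ : Irreducible ϖ) {k : Fin d} {v : ℕ}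
    {p : {i : Fin d // k ≤ i} → R ⧸ IsLocalRing.maximalIdeal R ^ v} :
    ϖ ^ v ∣ liftVec k v p k ↔ p ⟨k, le_rfl⟩ = 0 := by
  have h := mk_eq_of_pow_dvd hϖ v (x := liftVec k v p k) (y := 0)
  rw [sub_zero, map_zero] at h
  rw [h, liftVec, dif_pos le_rfl]
  constructor
  · intro h1
    exact (Ideal.Quotient.mk_out _).symm.trans h1
  · intro h1
    exact (Ideal.Quotient.mk_out _).trans h1

lemma eq_of_mem_primClass_liftVec (hϖ : Irreducible ϖ) {k : Fin d} {v : ℕ} (hv : v ≠ 0)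
    {p p' : {i : Fin d // k ≤ i} → R ⧸ IsLocalRing.maximalIdeal R ^ v} (hp : p ∈ primVec R k v)
    (hp' : p' ∈ primVec R k v) {c : Fin d → R} (hc : c ∈ primClass ϖ k v (liftVec k v p))
    (hc' : c ∈ primClass ϖ k v (liftVec k v p')) : p = p' := by
  ext ⟨i, hi⟩
  have h := dvd_sub_of_mem_primClass hϖ hv (exists_isUnit_liftVec hp) (exists_isUnit_liftVec hp')
    hc hc' hi
  rw [mk_eq_of_pow_dvd hϖ, liftVec, liftVec, dif_pos hi, dif_pos hi] at h
  exact (Ideal.Quotient.mk_out _).symm.trans (h.trans (Ideal.Quotient.mk_out _))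

lemma card_quotient_maximalIdeal_pow (v : ℕ) :
    Nat.card (R ⧸ IsLocalRing.maximalIdeal R ^ v) =
      Nat.card (IsLocalRing.ResidueField R) ^ v :=
  cardQuot_pow_of_prime (IsDiscreteValuationRing.not_a_field R)

variable [Finite (IsLocalRing.ResidueField R)]

lemma finite_quotient_maximalIdeal_pow (v : ℕ) :
    Finite (R ⧸ IsLocalRing.maximalIdeal R ^ v) := by
  refine Nat.finite_of_card_ne_zero ?_
  rw [card_quotient_maximalIdeal_pow]
  exact pow_ne_zero _ Nat.card_pos.ne'

lemma two_le_card_residueField : 2 ≤ Nat.card (IsLocalRing.ResidueField R) :=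
  Finite.one_lt_card

/-- The non-units of `R / 𝔪 ^ v` form the kernel of the reduction to the residue field. -/
lemma card_not_isUnit_out {v : ℕ} (hv : v ≠ 0) :
    Nat.card {a : R ⧸ IsLocalRing.maximalIdeal R ^ v // ¬ IsUnit a.out} =
      Nat.card (IsLocalRing.ResidueField R) ^ (v - 1) := by
  set 𝔪 := IsLocalRing.maximalIdeal R
  have hle : 𝔪 ^ v ≤ 𝔪 := Ideal.pow_le_self hv
  have := finite_quotient_maximalIdeal_pow (R := R) v
  let f : (R ⧸ 𝔪 ^ v) →+* (R ⧸ 𝔪) := Ideal.Quotient.factor hle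
  have hf : Function.Surjective f := Ideal.Quotient.factor_surjective hle
  have hker (a : R ⧸ 𝔪 ^ v) : ¬ IsUnit a.out ↔ a ∈ f.toAddMonoidHom.ker := by
    rw [AddMonoidHom.mem_ker]
    conv_rhs => rw [← Ideal.Quotient.mk_out a]
    change _ ↔ f (Ideal.Quotient.mk _ a.out) = 0
    rw [Ideal.Quotient.factor_mk, Ideal.Quotient.eq_zero_iff_mem]
    exact (IsLocalRing.mem_maximalIdeal _).symm
  have h1 : Nat.card {a : R ⧸ 𝔪 ^ v // ¬ IsUnit a.out} = Nat.card f.toAddMonoidHom.ker :=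
    Nat.card_congr (Equiv.subtypeEquivRight hker)
  have h2 := AddSubgroup.card_eq_card_quotient_mul_card_addSubgroup f.toAddMonoidHom.ker
  have h3 : Nat.card ((R ⧸ 𝔪 ^ v) ⧸ f.toAddMonoidHom.ker) =
      Nat.card (IsLocalRing.ResidueField R) :=
    Nat.card_congr (QuotientAddGroup.quotientKerEquivOfSurjective f.toAddMonoidHom hf).toEquiv
  rw [card_quotient_maximalIdeal_pow, h3, ← h1] at h2
  obtain ⟨n, rfl⟩ := Nat.exists_eq_succ_of_ne_zero hv
  rw [Nat.succ_eq_add_one, pow_succ', mul_eq_mul_left_iff] at h2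
  rw [Nat.succ_eq_add_one, Nat.add_sub_cancel]
  exact (h2.resolve_right Nat.card_pos.ne').symm

/-- Vectors, with entries in a finite type, that are not contained in a subset `S`, counted with or
without the condition that the entry at `k` is a given element of `S`. -/
lemma card_exists_notMem {ι A : Type*} [Fintype ι] [DecidableEq ι] [Finite A] (S : Set A) (k : ι)
    {z : A} (hz : z ∈ S) :
    (({p : ι → A | ∃ i, p i ∉ S}.ncard : ℝ) =
      (Nat.card A : ℝ) ^ Fintype.card ι - (Nat.card S : ℝ) ^ Fintype.card ι) ∧
    (({p : ι → A | (∃ i, p i ∉ S) ∧ p k = z}.ncard : ℝ) =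
      (Nat.card A : ℝ) ^ (Fintype.card ι - 1) - (Nat.card S : ℝ) ^ (Fintype.card ι - 1)) := by
  classical
  have := Fintype.ofFinite A
  have hcard (T : ι → Finset A) : (({p : ι → A | ∀ i, p i ∈ T i}.ncard : ℕ)) = ∏ i, (T i).card := by
    rw [← Fintype.card_piFinset, ← Set.ncard_coe_finset]
    congr 1
    ext p
    simp
  have hprod (m : ℕ) : ∏ i : ι, (if i = k then 1 else m) = m ^ (Fintype.card ι - 1) := by
    rw [Finset.prod_ite]
    simp [Finset.filter_ne', Finset.card_erase_of_mem]
  have hS : S.toFinset.card = Nat.card S := by rw [Nat.card_eq_fintype_card, Set.toFinset_card]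
  have hA : (Finset.univ : Finset A).card = Nat.card A := by
    rw [Nat.card_eq_fintype_card, Finset.card_univ]
  constructor
  · have h1 := hcard fun _ => S.toFinset
    have h2 := Set.ncard_add_ncard_compl {p : ι → A | ∃ i, p i ∉ S}
    have h3 : {p : ι → A | ∃ i, p i ∉ S}ᶜ = {p : ι → A | ∀ i, p i ∈ S.toFinset} := by
      ext p; simp
    rw [h3, h1, Finset.prod_const, Finset.card_univ, hS, Nat.card_fun,
      Nat.card_eq_fintype_card (α := ι)] at h2
    have h4 : (({p : ι → A | ∃ i, p i ∉ S}.ncard : ℕ) : ℝ) + (Nat.card S : ℝ) ^ Fintype.card ι =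
        (Nat.card A : ℝ) ^ Fintype.card ι := by exact_mod_cast h2
    linarith
  · have h1 := hcard fun i => if i = k then {z} else S.toFinset
    have h2 := hcard fun i => if i = k then {z} else Finset.univ
    simp only [apply_ite Finset.card, Finset.card_singleton, hprod, hS, hA] at h1 h2
    have h3 : {p : ι → A | ∀ i, p i ∈ (if i = k then {z} else (Finset.univ : Finset A))} =
        {p : ι → A | (∃ i, p i ∉ S) ∧ p k = z} ∪
          {p : ι → A | ∀ i, p i ∈ (if i = k then {z} else S.toFinset)} := by
      have key (p : ι → A) (T : Finset A) (hT : z ∈ T) :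
          (∀ i, p i ∈ (if i = k then {z} else T)) ↔ p k = z ∧ ∀ i, p i ∈ T := by
        constructor
        · intro h
          have hk : p k = z := by simpa using h k
          refine ⟨hk, fun i => ?_⟩
          by_cases hi : i = k
          · rw [hi, hk]; exact hT
          · simpa [hi] using h i
        · rintro ⟨hk, h⟩ i
          by_cases hi : i = k
          · simp [hi, hk]
          · simpa [hi] using h i
      ext p
      simp only [Set.mem_union, Set.mem_ofPred_eq]
      rw [key p _ (Finset.mem_univ z), key p _ (Set.mem_toFinset.2 hz)]
      simp only [Finset.mem_univ, implies_true, and_true, Set.mem_toFinset]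
      by_cases h : ∃ i, p i ∉ S
      · simp [h]
      · push Not at h
        simp [h]
    have h4 : Disjoint {p : ι → A | (∃ i, p i ∉ S) ∧ p k = z}
        {p : ι → A | ∀ i, p i ∈ (if i = k then {z} else S.toFinset)} := by
      rw [Set.disjoint_left]
      rintro p ⟨⟨i, hi⟩, hk⟩ h
      by_cases hik : i = k
      · exact hi (by rw [hik, hk]; exact hz)
      · have := h i
        rw [if_neg hik, Set.mem_toFinset] at this
        exact hi this
    have h5 := Set.ncard_union_eq h4
    rw [← h3, h1, h2] at h5
    have h6 : (Nat.card A : ℝ) ^ (Fintype.card ι - 1) =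
        (({p : ι → A | (∃ i, p i ∉ S) ∧ p k = z}.ncard : ℕ) : ℝ) +
          (Nat.card S : ℝ) ^ (Fintype.card ι - 1) := by exact_mod_cast h5
    linarith

/-- The proportion, among the primitive vectors of length `n` modulo `𝔪 ^ v`, of those whose first
coordinate vanishes is `tailFactor q n * q ^ (-v)`. -/
noncomputable def tailFactor (q n : ℕ) : ℝ := ((q : ℝ) ^ n - q) / ((q : ℝ) ^ n - 1)

lemma ncard_primVec_zero (k : Fin d) {v : ℕ} (hv : v ≠ 0) :
    ((primVec R k v ∩ {p | p ⟨k, le_rfl⟩ = 0}).ncard : ℝ) =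
      tailFactor (Nat.card (IsLocalRing.ResidueField R)) (d - k) *
        ((Nat.card (IsLocalRing.ResidueField R) : ℝ) ^ v)⁻¹ * (primVec R k v).ncard := by
  have := finite_quotient_maximalIdeal_pow (R := R) v
  set A := R ⧸ IsLocalRing.maximalIdeal R ^ v
  have hz : (0 : A) ∈ {a : A | ¬ IsUnit a.out} := by
    have h1 : (Ideal.Quotient.mk (IsLocalRing.maximalIdeal R ^ v)) (Quotient.out (0 : A)) = 0 :=
      Ideal.Quotient.mk_out _
    rw [Ideal.Quotient.eq_zero_iff_mem] at h1
    exact (IsLocalRing.mem_maximalIdeal _).1 (Ideal.pow_le_self hv h1)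
  obtain ⟨h1, h2⟩ := card_exists_notMem {a : A | ¬ IsUnit a.out}
    (⟨k, le_rfl⟩ : {i : Fin d // k ≤ i}) hz
  have hn : Fintype.card {i : Fin d // k ≤ i} = d - k := by
    rw [Fintype.card_subtype, ← Fin.card_Ici k]
    congr 1
    ext i
    simp
  have hS : Nat.card {a : A | ¬ IsUnit a.out} =
      Nat.card (IsLocalRing.ResidueField R) ^ (v - 1) := card_not_isUnit_out hv
  have hA : Nat.card A = Nat.card (IsLocalRing.ResidueField R) ^ v :=
    card_quotient_maximalIdeal_pow v
  have hP : primVec R k v = {p | ∃ i, p i ∉ {a : A | ¬ IsUnit a.out}} := by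
    ext p; simp [primVec, A]
  have hP0 : primVec R k v ∩ {p | p ⟨k, le_rfl⟩ = 0} =
      {p | (∃ i, p i ∉ {a : A | ¬ IsUnit a.out}) ∧ p ⟨k, le_rfl⟩ = 0} := by
    rw [hP]; rfl
  rw [hP0, hP, h1, h2, hn, hS, hA]
  have hq : 2 ≤ Nat.card (IsLocalRing.ResidueField R) := two_le_card_residueField
  obtain ⟨n, hdk⟩ : ∃ n, d - k = n + 1 := ⟨d - k - 1, by omega⟩
  obtain ⟨w, rfl⟩ := Nat.exists_eq_succ_of_ne_zero hv
  set q := Nat.card (IsLocalRing.ResidueField R)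
  have hq' : (2 : ℝ) ≤ q := by exact_mod_cast hq
  have hpos : (q : ℝ) ^ (n + 1) - 1 ≠ 0 := by
    have : (1 : ℝ) < (q : ℝ) ^ (n + 1) := one_lt_pow₀ (by linarith) (by omega)
    linarith
  rw [hdk, tailFactor]
  simp only [Nat.succ_eq_add_one, Nat.add_sub_cancel]
  push_cast
  have hq0 : (q : ℝ) ≠ 0 := by linarith
  field_simp
  ring

end Counting

end LUStat

namespace LUStat

/-! ### Adic topologies, and equivariance of minors -/

open MeasureTheory Matrix Topology

section Topology

variable {R : Type*} [CommRing R]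

lemma isTopologicalRing_of_isAdic [TopologicalSpace R] {I : Ideal R} (hI : IsAdic I) :
    IsTopologicalRing R := by
  unfold IsAdic at hI
  subst hI
  exact (Ideal.nonarchimedean I).toIsTopologicalRing

lemma t2Space_of_isAdic [TopologicalSpace R] {I : Ideal R} (hI : IsAdic I) [IsHausdorff I R] :
    T2Space R := by
  have := isTopologicalRing_of_isAdic hI
  let _ : UniformSpace R := IsTopologicalAddGroup.rightUniformSpace R
  have : IsUniformAddGroup R := isUniformAddGroup_of_addCommGroup
  exact hI.isHausdorff_iff.1 inferInstance

lemma isOpen_pow_of_isAdic [TopologicalSpace R] {I : Ideal R} (hI : IsAdic I) (n : ℕ) :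
    IsOpen ((I ^ n : Ideal R) : Set R) := by
  have := isTopologicalRing_of_isAdic hI
  exact (isAdic_iff.1 hI).1 n

/-- A complete ring is compact for the `I`-adic topology if all the quotients `R / I ^ n` are
finite, because these quotients make it totally bounded. -/
lemma compactSpace_of_isAdic [TopologicalSpace R] {I : Ideal R} (hI : IsAdic I)
    [IsAdicComplete I R] (hfin : ∀ n, Finite (R ⧸ I ^ n)) : CompactSpace R := by
  have := isTopologicalRing_of_isAdic hI
  let _ : UniformSpace R := IsTopologicalAddGroup.rightUniformSpace R
  have : IsUniformAddGroup R := isUniformAddGroup_of_addCommGroup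
  have hcomplete : CompleteSpace R := (hI.isAdicComplete_iff.1 inferInstance).1
  refine ⟨isCompact_iff_totallyBounded_isComplete.2 ⟨?_, isComplete_univ⟩⟩
  intro s hs
  rw [uniformity_eq_comap_nhds_zero, Filter.mem_comap] at hs
  obtain ⟨t, ht, hts⟩ := hs
  obtain ⟨n, -, hn⟩ := hI.hasBasis_nhds_zero.mem_iff.1 ht
  have := hfin n
  refine ⟨Set.range fun a : R ⧸ I ^ n => a.out, Set.finite_range _, fun x _ => ?_⟩
  simp only [Set.mem_iUnion]
  refine ⟨_, ⟨Ideal.Quotient.mk (I ^ n) x, rfl⟩, hts (hn ?_)⟩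
  change (Quotient.out (Ideal.Quotient.mk (I ^ n) x) : R) - x ∈ I ^ n
  rw [← Ideal.Quotient.eq]
  exact Ideal.Quotient.mk_out _

end Topology

section Minors

/-- `g` acts trivially on the first `k` coordinates: it is of the form `diag(1, g')` with an
identity block of size `k`. -/
def FixesBelow {A : Type*} [CommRing A] {d : ℕ} (k : Fin d) (g : Matrix (Fin d) (Fin d) A) : Prop :=
  g * diagonal (fun i => if i < k then 1 else 0) = diagonal (fun i => if i < k then 1 else 0) ∧
  diagonal (fun i => if i < k then 1 else 0) * g = diagonal (fun i => if i < k then 1 else 0)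

variable {A : Type*} [CommRing A] {d : ℕ}

lemma FixesBelow.apply_of_lt_left {k : Fin d} {g : Matrix (Fin d) (Fin d) A} (h : FixesBelow k g)
    {i : Fin d} (hi : i < k) (j : Fin d) : g i j = if i = j then 1 else 0 := by
  have := congrFun (congrFun h.2 i) j
  simpa [diagonal_mul, hi, diagonal_apply] using this

lemma FixesBelow.apply_of_lt_right {k : Fin d} {g : Matrix (Fin d) (Fin d) A} (h : FixesBelow k g)
    {j : Fin d} (hj : j < k) (i : Fin d) : g i j = if i = j then 1 else 0 := by
  have := congrFun (congrFun h.1 i) j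
  rw [mul_diagonal, diagonal_apply] at this
  rw [if_pos hj, mul_one] at this
  rw [this]
  by_cases hij : i = j
  · simp [hij, hj]
  · simp [hij]

lemma fixesBelow_of_apply {k : Fin d} {g : Matrix (Fin d) (Fin d) A}
    (h₁ : ∀ i j, i < k → g i j = if i = j then 1 else 0)
    (h₂ : ∀ i j, j < k → g i j = if i = j then 1 else 0) : FixesBelow k g := by
  constructor
  · ext i j
    rw [mul_diagonal, diagonal_apply]
    by_cases hj : j < k
    · rw [h₂ i j hj]
      by_cases hij : i = j <;> simp [hij, hj]
    · by_cases hij : i = j <;> simp [hij, hj]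
  · ext i j
    rw [diagonal_mul, diagonal_apply]
    by_cases hi : i < k
    · rw [h₁ i j hi]
      by_cases hij : i = j <;> simp [hij, hi]
    · obtain rfl | hij := eq_or_ne i j <;> simp [*]

lemma FixesBelow.inv {k : Fin d} {g : Matrix (Fin d) (Fin d) A} (h : FixesBelow k g)
    (hg : IsUnit g.det) : FixesBelow k g⁻¹ := by
  constructor
  · conv_lhs => rw [← h.1]
    rw [← Matrix.mul_assoc, nonsing_inv_mul _ hg, Matrix.one_mul]
  · conv_lhs => rw [← h.2]
    rw [Matrix.mul_assoc, mul_nonsing_inv _ hg, Matrix.mul_one]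

lemma FixesBelow.mono {k l : Fin d} (hlk : l ≤ k) {g : Matrix (Fin d) (Fin d) A}
    (h : FixesBelow k g) : FixesBelow l g :=
  fixesBelow_of_apply (fun _ j hi => h.apply_of_lt_left (hi.trans_le hlk) j)
    (fun i _ hj => h.apply_of_lt_right (hj.trans_le hlk) i)

/-- The vector of minors `(minor k i M)_i` is equivariant under the matrices that fix the first `k`
coordinates, since `minor k i M` is linear in the row `i`. -/
lemma minor_mul {k : Fin d} {g : Matrix (Fin d) (Fin d) A} (h : FixesBelow k g)
    (M : Matrix (Fin d) (Fin d) A) (i : Fin d) :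
    minor k i (g * M) = ∑ j, g i j * minor k j M := by
  set s : {a : Fin d // a ≤ k} → Fin d := fun a => a with hs
  set k' : {a : Fin d // a ≤ k} := ⟨k, le_rfl⟩ with hk'
  have h1 (j : Fin d) : minor k j M = cramer (M.submatrix s s)ᵀ (fun b => M j (s b)) k' := by
    rw [cramer_transpose_apply]; rfl
  have h2 : minor k i (g * M) = cramer (M.submatrix s s)ᵀ (fun b => (g * M) i (s b)) k' := by
    rw [cramer_transpose_apply, minor]
    congr 1
    ext a b
    by_cases ha : a = k'
    · rw [ha]; simp [hs, hk']
    · have hak : (a : Fin d) < k := lt_of_le_of_ne a.2 fun e => ha (Subtype.ext e)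
      rw [updateRow_apply, updateRow_apply, if_neg ha, if_neg ha]
      simp [mul_apply, h.apply_of_lt_left hak, hs]
  have h3 : (fun b => (g * M) i (s b)) = ∑ j, g i j • fun b => M j (s b) := by
    ext b
    simp [mul_apply]
  rw [h2, h3, map_sum, Finset.sum_apply]
  refine Finset.sum_congr rfl fun j _ => ?_
  rw [map_smul, h1, Pi.smul_apply, smul_eq_mul]

lemma continuous_minor [TopologicalSpace A] [IsTopologicalRing A] (k i : Fin d) :
    Continuous fun M : Matrix (Fin d) (Fin d) A => minor k i M := by
  unfold minor
  refine Continuous.matrix_det (continuous_matrix fun a b => ?_)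
  by_cases ha : a = ⟨k, le_rfl⟩
  · simpa [updateRow_apply, ha] using continuous_id.matrix_elem i (b : Fin d)
  · simpa [updateRow_apply, ha] using continuous_id.matrix_elem (a : Fin d) (b : Fin d)

/-- As a function of `t`, the minor `minor k k (M + t)` is a characteristic polynomial. -/
lemma finite_setOf_minor_add_diagonal_eq_zero [IsDomain A] (k : Fin d)
    (M : Matrix (Fin d) (Fin d) A) :
    {t : A | minor k k (M + diagonal fun _ => t) = 0}.Finite ∧
      {t : A | minor k k (M + diagonal fun _ => t) = 0}.ncard ≤ d := by
  classical
  set s : {a : Fin d // a ≤ k} → Fin d := fun a => a with hs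
  set p := (-(M.submatrix s s)).charpoly with hp
  have h0 : p ≠ 0 := (charpoly_monic _).ne_zero
  have h1 : {t : A | minor k k (M + diagonal fun _ => t) = 0} = p.roots.toFinset := by
    ext t
    rw [Finset.mem_coe, Multiset.mem_toFinset, Polynomial.mem_roots h0, Polynomial.IsRoot.def, hp,
      eval_charpoly, Set.mem_ofPred_eq, minor_self]
    have : (M + diagonal fun _ => t).submatrix s s = scalar _ t - -(M.submatrix s s) := by
      ext a b
      simp [diagonal_apply, hs, Subtype.ext_iff, add_comm]
    rw [← this]
  rw [h1]
  refine ⟨Finset.finite_toSet _, ?_⟩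
  rw [Set.ncard_coe_finset]
  refine (Multiset.toFinset_card_le _).trans ((Polynomial.card_roots' p).trans ?_)
  rw [hp, charpoly_natDegree_eq_dim]
  simpa using Fintype.card_subtype_le fun a : Fin d => a ≤ k

end Minors

end LUStat

namespace LUStat

/-! ### Invariance of the Haar measure and the law of `V_L` -/

open MeasureTheory Matrix Topology

section Equivariance

variable {R : Type*} [CommRing R] {ϖ : R} {d : ℕ}

lemma mem_primClass_mulVec {k : Fin d} {g : Matrix (Fin d) (Fin d) R} (h : FixesBelow k g) (v : ℕ)
    {u : Fin d → R} {ω : Matrix (Fin d) (Fin d) R}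
    (hω : (fun i => minor k i ω) ∈ primClass ϖ k v u) :
    (fun i => minor k i (g * ω)) ∈ primClass ϖ k v (g *ᵥ u) := by
  obtain ⟨e, he⟩ := hω
  refine ⟨e, fun i hi => ?_⟩
  have h1 : minor k i (g * ω) - ϖ ^ e * (g *ᵥ u) i =
      ∑ j, g i j * (minor k j ω - ϖ ^ e * u j) := by
    rw [minor_mul h, mulVec, dotProduct, Finset.mul_sum, ← Finset.sum_sub_distrib]
    exact Finset.sum_congr rfl fun j _ => by ring
  change _ ∣ minor k i (g * ω) - ϖ ^ e * (g *ᵥ u) i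
  rw [h1]
  refine Finset.dvd_sum fun j _ => ?_
  by_cases hj : k ≤ j
  · exact (he j hj).mul_left _
  · have hjk := not_le.1 hj
    rw [h.apply_of_lt_right hjk, if_neg (hjk.trans_le hi).ne', zero_mul]
    exact dvd_zero _

lemma mem_primClass_mulVec_iff {k : Fin d} {g : Matrix (Fin d) (Fin d) R} (h : FixesBelow k g)
    (hg : IsUnit g.det) (v : ℕ) {u : Fin d → R} {ω : Matrix (Fin d) (Fin d) R} :
    (fun i => minor k i (g * ω)) ∈ primClass ϖ k v (g *ᵥ u) ↔
      (fun i => minor k i ω) ∈ primClass ϖ k v u := by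
  refine ⟨fun hω => ?_, mem_primClass_mulVec h v⟩
  have := mem_primClass_mulVec (h.inv hg) v hω
  rwa [← Matrix.mul_assoc, nonsing_inv_mul _ hg, Matrix.one_mul, mulVec_mulVec,
    nonsing_inv_mul _ hg, one_mulVec] at this

/-- A primitive vector whose `k`-th coordinate is a unit is the image of the `k`-th basis vector
under an invertible matrix that fixes the first `k` coordinates. -/
lemma exists_mulVec_single_eq {k : Fin d} {u : Fin d → R} (hu : ∀ i, i < k → u i = 0)
    (huk : IsUnit (u k)) :
    ∃ g : Matrix (Fin d) (Fin d) R, FixesBelow k g ∧ IsUnit g.det ∧ g *ᵥ Pi.single k 1 = u := by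
  refine ⟨(1 : Matrix (Fin d) (Fin d) R).updateCol k u,
    fixesBelow_of_apply (fun i j hi => ?_) (fun i j hj => ?_), ?_, ?_⟩
  · by_cases hj : j = k
    · subst hj
      simp [hu i hi, hi.ne]
    · simp [hj, one_apply]
  · simp [hj.ne, one_apply]
  · rw [← cramer_apply, cramer_one]
    exact huk
  · ext i
    simp

/-- Adding a coordinate `i > k` to the `k`-th one. -/
lemma exists_mulVec_isUnit {k i : Fin d} (hki : k < i) (u : Fin d → R) :
    ∃ g : Matrix (Fin d) (Fin d) R, FixesBelow k g ∧ IsUnit g.det ∧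
      (∀ j, j < k → (g *ᵥ u) j = u j) ∧ (g *ᵥ u) k = u k + u i := by
  have hap (a b : Fin d) : transvection k i (1 : R) a b =
      (if a = b then 1 else 0) + if k = a ∧ i = b then 1 else 0 := by
    simp [transvection, Matrix.single_apply, one_apply]
  refine ⟨transvection k i 1, fixesBelow_of_apply (fun a b ha => ?_) (fun a b hb => ?_), ?_, ?_, ?_⟩
  · simp [hap, ha.ne']
  · simp [hap, (hb.trans hki).ne']
  · simp [det_transvection_of_ne _ _ hki.ne]
  · intro j hj
    simp [transvection, add_mulVec, single_mulVec, hj.ne]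
  · simp [transvection, add_mulVec, single_mulVec]

/-- Where the leading principal minors do not vanish, the event that the `l`-th column of the
`L`-part has an entry of valuation at most `-v`, expressed by divisibility of minors. -/
def tailSet (ϖ : R) (l : Fin d) (v : ℕ) : Set (Matrix (Fin d) (Fin d) R) :=
  {ω | ∃ i, l ≤ i ∧ ϖ ^ v * minor l i ω ∣ minor l l ω}

variable [IsDomain R] [IsDiscreteValuationRing R]

lemma mem_tailSet_of_mul {k l : Fin d} (hlk : l < k) {g : Matrix (Fin d) (Fin d) R}
    (h : FixesBelow k g) (v : ℕ) {ω : Matrix (Fin d) (Fin d) R} (hω : g * ω ∈ tailSet ϖ l v) :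
    ω ∈ tailSet ϖ l v := by
  obtain ⟨i, -, hdvd⟩ := hω
  obtain ⟨j, hj, hmin⟩ := exists_forall_ge_dvd l fun j => minor l j ω
  refine ⟨j, hj, ?_⟩
  have hl : minor l l (g * ω) = minor l l ω := by
    rw [minor_mul (h.mono hlk.le)]
    simp [h.apply_of_lt_left hlk]
  rw [hl] at hdvd
  refine dvd_trans (mul_dvd_mul_left _ ?_) hdvd
  rw [minor_mul (h.mono hlk.le)]
  refine Finset.dvd_sum fun j' _ => Dvd.dvd.mul_left ?_ _
  by_cases hj' : l ≤ j'
  · exact hmin j' hj'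
  · rw [minor_eq_zero_of_lt (not_le.1 hj')]
    exact dvd_zero _

lemma mul_mem_tailSet_iff {k l : Fin d} (hlk : l < k) {g : Matrix (Fin d) (Fin d) R}
    (h : FixesBelow k g) (hg : IsUnit g.det) (v : ℕ) {ω : Matrix (Fin d) (Fin d) R} :
    g * ω ∈ tailSet ϖ l v ↔ ω ∈ tailSet ϖ l v := by
  refine ⟨mem_tailSet_of_mul hlk h v, fun hω => mem_tailSet_of_mul hlk (h.inv hg) v ?_⟩
  rwa [← Matrix.mul_assoc, nonsing_inv_mul _ hg, Matrix.one_mul]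

end Equivariance

section Topology

variable {R : Type*} [CommRing R] [TopologicalSpace R] [IsTopologicalRing R] {ϖ : R} {d : ℕ}

lemma isClosed_tailSet [CompactSpace R] [T2Space R] (ϖ : R) (l : Fin d) (v : ℕ) : IsClosed (tailSet (d := d) ϖ l v) := by
  have hdvd : IsClosed {x : R × R | ϖ ^ v * x.1 ∣ x.2} := by
    have h1 : {x : R × R | ϖ ^ v * x.1 ∣ x.2} =
        Set.range fun y : R × R => (y.1, ϖ ^ v * y.1 * y.2) := by
      ext ⟨a, b⟩
      simp only [Set.mem_ofPred_eq, Set.mem_range, Prod.exists, Prod.mk.injEq]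
      constructor
      · rintro ⟨c, rfl⟩
        exact ⟨a, c, rfl, rfl⟩
      · rintro ⟨_, c, rfl, rfl⟩
        exact Dvd.intro c rfl
    rw [h1]
    exact (isCompact_range (by fun_prop)).isClosed
  have h2 : tailSet (d := d) ϖ l v = ⋃ i ∈ Finset.univ.filter (l ≤ ·),
      (fun ω => (minor l i ω, minor l l ω)) ⁻¹' {x : R × R | ϖ ^ v * x.1 ∣ x.2} := by
    ext ω; simp [tailSet]
  rw [h2]
  exact isClosed_biUnion_finset fun i _ =>
    hdvd.preimage ((continuous_minor l i).prodMk (continuous_minor l l))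

lemma isOpen_setOf_mem_primClass [IsDomain R] [IsDiscreteValuationRing R]
    (hR : IsAdic (IsLocalRing.maximalIdeal R)) (hϖ : Irreducible ϖ) (k : Fin d) (v : ℕ) (u : Fin d → R) :
    IsOpen {ω : Matrix (Fin d) (Fin d) R | (fun i => minor k i ω) ∈ primClass ϖ k v u} := by
  have hpow (n : ℕ) : IsOpen {x : R | ϖ ^ n ∣ x} := by
    convert isOpen_pow_of_isAdic hR n using 1
    ext x
    rw [hϖ.maximalIdeal_eq, Ideal.span_singleton_pow, SetLike.mem_coe, Ideal.mem_span_singleton]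
    rfl
  have h1 : {ω : Matrix (Fin d) (Fin d) R | (fun i => minor k i ω) ∈ primClass ϖ k v u} =
      ⋃ e : ℕ, ⋂ i ∈ Finset.univ.filter (k ≤ ·),
        (fun ω => minor k i ω - ϖ ^ e * u i) ⁻¹' {x : R | ϖ ^ (e + v) ∣ x} := by
    ext ω; simp [primClass]
  rw [h1]
  exact isOpen_iUnion fun e => isOpen_biInter_finset fun i _ =>
    (hpow _).preimage ((continuous_minor k i).sub continuous_const)

end Topology

section Measure

variable {R : Type*} [CommRing R] [TopologicalSpace R] [IsTopologicalRing R] [T2Space R] {ϖ : R} {d : ℕ}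
  [MeasurableSpace (Matrix (Fin d) (Fin d) R)] [BorelSpace (Matrix (Fin d) (Fin d) R)]
  {μ : Measure (Matrix (Fin d) (Fin d) R)} [μ.IsAddHaarMeasure] [IsProbabilityMeasure μ]

/-- A leading principal minor vanishes on a null set: the set of its zeros has infinitely many
translates by scalar matrices, and every point belongs to at most `d` of them. -/
lemma ae_minor_ne_zero [IsDomain R] [Infinite R] (k : Fin d) : ∀ᵐ ω ∂μ, minor k k ω ≠ 0 := by
  classical
  set N : Set (Matrix (Fin d) (Fin d) R) := {ω | minor k k ω = 0} with hN
  have hNm : MeasurableSet N :=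
    (isClosed_singleton.preimage (continuous_minor (A := R) k k)).measurableSet
  have key (F : Finset R) : (F.card : ENNReal) * μ N ≤ d := by
    have h1 (t : R) : ∫⁻ ω, N.indicator 1 (ω + diagonal fun _ => t) ∂μ = μ N := by
      rw [lintegral_add_right_eq_self (μ := μ) (N.indicator (1 : Matrix (Fin d) (Fin d) R → ENNReal)),
        lintegral_indicator_one hNm]
    calc (F.card : ENNReal) * μ N
        = ∑ t ∈ F, ∫⁻ ω, N.indicator 1 (ω + diagonal fun _ => t) ∂μ := by simp [h1]
      _ = ∫⁻ ω, ∑ t ∈ F, N.indicator 1 (ω + diagonal fun _ => t) ∂μ := by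
        rw [lintegral_finsetSum]
        intro t _
        exact (measurable_one.indicator hNm).comp (measurable_add_const _)
      _ ≤ ∫⁻ _, d ∂μ := by
        refine lintegral_mono fun ω => ?_
        obtain ⟨hfin, hcard⟩ := finite_setOf_minor_add_diagonal_eq_zero k ω
        have h2 : ∑ t ∈ F, N.indicator (1 : Matrix (Fin d) (Fin d) R → ENNReal) (ω + diagonal fun _ => t) =
            ((F.filter fun t => ω + (diagonal fun _ => t) ∈ N).card : ENNReal) := by
          simp [Set.indicator_apply]
        rw [h2]
        refine Nat.cast_le.2 (le_trans ?_ hcard)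
        rw [← Set.ncard_coe_finset]
        exact Set.ncard_le_ncard (fun t ht => (Finset.mem_filter.1 ht).2) hfin
      _ = d := by simp
  rw [ae_iff]
  simp only [ne_eq, not_not]
  by_contra h0
  have h0' : μ N ≠ 0 := h0
  obtain ⟨n, hn⟩ := ENNReal.exists_nat_mul_gt h0' (ENNReal.natCast_ne_top d)
  obtain ⟨F, hF⟩ := Infinite.exists_subset_card_eq R n
  have := key F
  rw [hF] at this
  exact absurd this (not_le.2 hn)

variable [CompactSpace R]

lemma measurePreserving_mul_left {g : Matrix (Fin d) (Fin d) R} (hg : IsUnit g.det) :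
    MeasurePreserving (fun ω => g * ω) μ μ := by
  have : CompactSpace (Matrix (Fin d) (Fin d) R) :=
    inferInstanceAs (CompactSpace (Fin d → Fin d → R))
  let e : Matrix (Fin d) (Fin d) R ≃+ Matrix (Fin d) (Fin d) R :=
    { toFun := fun ω => g * ω
      invFun := fun ω => g⁻¹ * ω
      left_inv := fun ω => nonsing_inv_mul_cancel_left g ω hg
      right_inv := fun ω => mul_nonsing_inv_cancel_left g ω hg
      map_add' := fun x y => Matrix.mul_add g x y }
  have he : Continuous e := continuous_const.matrix_mul continuous_id
  have he' : Continuous e.symm := continuous_const.matrix_mul continuous_id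
  have h1 : (μ.map e).IsAddHaarMeasure := e.isAddHaarMeasure_map μ he he'
  have h2 : IsProbabilityMeasure (μ.map e) := Measure.isProbabilityMeasure_map he.aemeasurable
  exact ⟨he.measurable, Measure.isAddHaarMeasure_eq_of_isProbabilityMeasure _ _⟩

variable [IsDomain R] [IsDiscreteValuationRing R] {E : Set (Matrix (Fin d) (Fin d) R)}

lemma measure_inter_primClass_mulVec (hR : IsAdic (IsLocalRing.maximalIdeal R))
    (hϖ : Irreducible ϖ) {k : Fin d} {g : Matrix (Fin d) (Fin d) R} (h : FixesBelow k g)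
    (hg : IsUnit g.det) (hE : MeasurableSet E) (hinv : ∀ ω, g * ω ∈ E ↔ ω ∈ E) (v : ℕ)
    (u : Fin d → R) :
    μ (E ∩ {ω | (fun i => minor k i ω) ∈ primClass ϖ k v (g *ᵥ u)}) =
      μ (E ∩ {ω | (fun i => minor k i ω) ∈ primClass ϖ k v u}) := by
  rw [← (measurePreserving_mul_left (μ := μ) hg).measure_preimage
    (hE.inter (isOpen_setOf_mem_primClass hR hϖ k v _).measurableSet).nullMeasurableSet]
  congr 1
  ext ω
  exact and_congr (hinv ω) (mem_primClass_mulVec_iff h hg v)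

/-- Within an invariant event, the reduction of the primitive part of the vector of minors is
uniformly distributed, because the group acts transitively on primitive vectors. -/
lemma measure_inter_primClass_eq (hR : IsAdic (IsLocalRing.maximalIdeal R)) (hϖ : Irreducible ϖ)
    {k : Fin d} (hE : MeasurableSet E)
    (hinv : ∀ g : Matrix (Fin d) (Fin d) R, FixesBelow k g → IsUnit g.det →
      ∀ ω, g * ω ∈ E ↔ ω ∈ E) (v : ℕ) {u : Fin d → R} (hu : ∃ i, k ≤ i ∧ IsUnit (u i))
    (hu0 : ∀ i, i < k → u i = 0) :
    μ (E ∩ {ω | (fun i => minor k i ω) ∈ primClass ϖ k v u}) =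
      μ (E ∩ {ω | (fun i => minor k i ω) ∈ primClass ϖ k v (Pi.single k 1)}) := by
  have key {u : Fin d → R} (hu0 : ∀ i, i < k → u i = 0) (huk : IsUnit (u k)) :
      μ (E ∩ {ω | (fun i => minor k i ω) ∈ primClass ϖ k v u}) =
        μ (E ∩ {ω | (fun i => minor k i ω) ∈ primClass ϖ k v (Pi.single k 1)}) := by
    obtain ⟨g, h, hg, rfl⟩ := exists_mulVec_single_eq hu0 huk
    exact measure_inter_primClass_mulVec hR hϖ h hg hE (hinv g h hg) v _
  by_cases huk : IsUnit (u k)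
  · exact key hu0 huk
  obtain ⟨i, hi, hui⟩ := hu
  have hki : k < i := lt_of_le_of_ne hi fun e => huk (e ▸ hui)
  obtain ⟨g, h, hg, h1, h2⟩ := exists_mulVec_isUnit hki u
  rw [← measure_inter_primClass_mulVec hR hϖ h hg hE (hinv g h hg) v u]
  refine key (fun j hj => by rw [h1 j hj, hu0 j hj]) ?_
  rw [h2]
  -- in a local ring the sum of a non-unit and a unit is a unit
  by_contra hn
  have h3 := sub_mem ((IsLocalRing.mem_maximalIdeal _).2 hn) ((IsLocalRing.mem_maximalIdeal _).2 huk)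
  rw [add_sub_cancel_left] at h3
  exact (IsLocalRing.mem_maximalIdeal _).1 h3 hui

variable [Finite (IsLocalRing.ResidueField R)]

/-- Within an event that is invariant under the matrices fixing the first `k` coordinates, the
conditional probability of `tailSet ϖ k v` is the proportion of primitive vectors modulo `𝔪 ^ v`
with vanishing first coordinate. -/
lemma measureReal_inter_tailSet [Infinite R] (hR : IsAdic (IsLocalRing.maximalIdeal R))
    (hϖ : Irreducible ϖ) {k : Fin d} (hE : MeasurableSet E)
    (hinv : ∀ g : Matrix (Fin d) (Fin d) R, FixesBelow k g → IsUnit g.det →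
      ∀ ω, g * ω ∈ E ↔ ω ∈ E) {v : ℕ} (hv : v ≠ 0) :
    μ.real (E ∩ tailSet ϖ k v) =
      tailFactor (Nat.card (IsLocalRing.ResidueField R)) (d - k) *
        ((Nat.card (IsLocalRing.ResidueField R) : ℝ) ^ v)⁻¹ * μ.real E := by
  have hfin := finite_quotient_maximalIdeal_pow (R := R) v
  set S : ({i : Fin d // k ≤ i} → R ⧸ IsLocalRing.maximalIdeal R ^ v) →
      Set (Matrix (Fin d) (Fin d) R) :=
    fun p => E ∩ {ω | (fun i => minor k i ω) ∈ primClass ϖ k v (liftVec k v p)} with hS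
  set κ := μ.real (E ∩ {ω | (fun i => minor k i ω) ∈ primClass ϖ k v (Pi.single k 1)})
  have hSκ (p) (hp : p ∈ primVec R k v) : μ.real (S p) = κ := by
    refine congrArg ENNReal.toReal (measure_inter_primClass_eq hR hϖ hE hinv v
      (exists_isUnit_liftVec hp) fun i hi => ?_)
    rw [liftVec, dif_neg (not_le.2 hi)]
  have hunion (P : Set ({i : Fin d // k ≤ i} → R ⧸ IsLocalRing.maximalIdeal R ^ v))
      (hP : P ⊆ primVec R k v) : μ.real (⋃ p ∈ P, S p) = P.ncard * κ := by
    have hPf : P.Finite := Set.toFinite P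
    have h1 : (⋃ p ∈ P, S p) = ⋃ p ∈ hPf.toFinset, S p := by simp
    rw [h1, measureReal_biUnion_finset]
    · rw [Finset.sum_congr rfl fun p hp => hSκ p (hP (hPf.mem_toFinset.1 hp)), Finset.sum_const,
        nsmul_eq_mul, Set.ncard_eq_toFinset_card P hPf]
    · intro p hp p' hp' hne
      rw [Function.onFun, Set.disjoint_left]
      intro ω hω hω'
      exact hne (eq_of_mem_primClass_liftVec hϖ hv (hP (hPf.mem_toFinset.1 hp))
        (hP (hPf.mem_toFinset.1 hp')) hω.2 hω'.2)
    · intro p _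
      exact hE.inter (isOpen_setOf_mem_primClass hR hϖ k v _).measurableSet
  have hae := ae_minor_ne_zero (μ := μ) k
  have hEeq : μ.real E = (primVec R k v).ncard * κ := by
    rw [← hunion _ subset_rfl]
    refine measureReal_congr ?_
    filter_upwards [hae] with ω hω
    refine propext ⟨fun h => ?_, fun h => ?_⟩
    · obtain ⟨p, hp, hpc⟩ := exists_mem_primClass_liftVec hϖ hv
        (c := fun i => minor k i ω) ⟨k, le_rfl, hω⟩
      exact Set.mem_biUnion hp ⟨h, hpc⟩
    · obtain ⟨p, _, hpS⟩ := Set.mem_iUnion₂.1 h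
      exact hpS.1
  have hTeq : μ.real (E ∩ tailSet ϖ k v) =
      (primVec R k v ∩ {p | p ⟨k, le_rfl⟩ = 0}).ncard * κ := by
    rw [← hunion _ Set.inter_subset_left]
    refine measureReal_congr ?_
    filter_upwards [hae] with ω hω
    refine propext ⟨fun h => ?_, fun h => ?_⟩
    · obtain ⟨p, hp, hpc⟩ := exists_mem_primClass_liftVec hϖ hv
        (c := fun i => minor k i ω) ⟨k, le_rfl, hω⟩
      have h1 := (exists_pow_mul_dvd_iff_of_mem_primClass hϖ hv (exists_isUnit_liftVec hp) hpc).1 h.2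
      exact Set.mem_biUnion ⟨hp, (pow_dvd_liftVec_iff hϖ).1 h1⟩ ⟨h.1, hpc⟩
    · obtain ⟨p, ⟨hp, hp0⟩, hpS⟩ := Set.mem_iUnion₂.1 h
      exact ⟨hpS.1, (exists_pow_mul_dvd_iff_of_mem_primClass hϖ hv (exists_isUnit_liftVec hp)
        hpS.2).2 ((pow_dvd_liftVec_iff hϖ).2 hp0)⟩
  rw [hTeq, hEeq, ncard_primVec_zero k hv]
  ring

/-- The law of `V_L`. The event for the columns before the `k`-th one is invariant under the matrices
that fix the first `k` coordinates, so that each column contributes its own factor. -/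
lemma measureReal_iInter_compl_tailSet [Infinite R] (hR : IsAdic (IsLocalRing.maximalIdeal R))
    (hϖ : Irreducible ϖ) {v : ℕ} (hv : v ≠ 0) :
    μ.real (⋂ k : Fin d, (tailSet ϖ k v)ᶜ) =
      ∏ k : Fin d, (1 - tailFactor (Nat.card (IsLocalRing.ResidueField R)) (d - k) *
        ((Nat.card (IsLocalRing.ResidueField R) : ℝ) ^ v)⁻¹) := by
  set f : Fin d → ℝ := fun k => 1 - tailFactor (Nat.card (IsLocalRing.ResidueField R)) (d - k) *
        ((Nat.card (IsLocalRing.ResidueField R) : ℝ) ^ v)⁻¹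
  set G : ℕ → Set (Matrix (Fin d) (Fin d) R) :=
    fun n => {ω | ∀ l : Fin d, (l : ℕ) < n → ω ∉ tailSet ϖ l v} with hG
  have hGm (n : ℕ) : MeasurableSet (G n) := by
    have : G n = ⋂ l ∈ Finset.univ.filter (fun l : Fin d => (l : ℕ) < n), (tailSet ϖ l v)ᶜ := by
      ext ω; simp [hG]
    rw [this]
    exact Finset.measurableSet_biInter _ fun l _ => (isClosed_tailSet ϖ l v).measurableSet.compl
  have key (n : ℕ) (hn : n ≤ d) :
      μ.real (G n) = ∏ k : Fin n, f (Fin.castLE hn k) := by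
    induction n with
    | zero => simp [hG]
    | succ n ih =>
      rw [Fin.prod_univ_castSucc]
      have h1 := ih (by omega)
      let k : Fin d := ⟨n, by omega⟩
      have h2 : G (n + 1) = G n \ (G n ∩ tailSet ϖ k v) := by
        ext ω
        simp only [hG, Set.mem_sdiff, Set.mem_inter_iff, Set.mem_ofPred_eq, not_and]
        constructor
        · intro h
          exact ⟨fun l hl => h l (by omega), fun _ => h k (by simp [k])⟩
        · rintro ⟨h, h'⟩ l hl
          rcases Nat.lt_succ_iff_lt_or_eq.1 hl with hl | hl
          · exact h l hl
          · have : l = k := Fin.ext hl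
            exact this ▸ h' h
      rw [h2, measureReal_sdiff Set.inter_subset_left
        ((hGm n).inter (isClosed_tailSet ϖ k v).measurableSet),
        measureReal_inter_tailSet hR hϖ (hGm n) ?_ hv, h1]
      · change _ = _ * f k
        simp only [f, Fin.castLE, Fin.val_castSucc]
        ring
      · intro g h hg ω
        refine forall₂_congr fun l hl => not_congr (mul_mem_tailSet_iff ?_ h hg v)
        exact hl
  have h3 : (⋂ k : Fin d, (tailSet ϖ k v)ᶜ) = G d := by
    ext ω; simp [hG]
  rw [h3, key d le_rfl]
  rfl

end Measure

end LUStat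

namespace LUStat

/-! ### Expectation and bounds -/

open MeasureTheory

section Expectation

/-- The expectation of a nonnegative integer variable is the sum of its tails. -/
lemma integral_eq_tsum_measureReal {Ω : Type*} [MeasurableSpace Ω] {μ : Measure Ω}
    [IsFiniteMeasure μ] {X : Ω → ℤ} (hX : ∀ ω, 0 ≤ X ω) {U : ℕ → Set Ω}
    (hU : ∀ n, MeasurableSet (U n)) (hXU : ∀ᵐ ω ∂μ, ∀ n : ℕ, ((n + 1 : ℕ) : ℤ) ≤ X ω ↔ ω ∈ U n)
    (hs : Summable fun n => μ.real (U n)) :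
    Integrable (fun ω => (X ω : ℝ)) μ ∧ ∫ ω, (X ω : ℝ) ∂μ = ∑' n, μ.real (U n) := by
  set W : Ω → ENNReal := fun ω => ∑' n, (U n).indicator 1 ω with hW
  have hWm : Measurable W := Measurable.tsum fun n => measurable_one.indicator (hU n)
  have hWX : (fun ω => (W ω).toReal) =ᵐ[μ] fun ω => (X ω : ℝ) := by
    filter_upwards [hXU] with ω hω
    obtain ⟨N, hN⟩ := Int.eq_ofNat_of_zero_le (hX ω)
    have h1 (n : ℕ) : (U n).indicator (1 : Ω → ENNReal) ω = if n ∈ Finset.range N then 1 else 0 := by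
      have h2 : ω ∈ U n ↔ n ∈ Finset.range N := by
        rw [← hω n, hN, Finset.mem_range]
        omega
      by_cases h : ω ∈ U n
      · rw [Set.indicator_of_mem h, if_pos (h2.1 h), Pi.one_apply]
      · rw [Set.indicator_of_notMem h, if_neg (mt h2.2 h)]
    have h3 : W ω = N := by
      rw [hW]
      simp only [h1]
      rw [tsum_eq_sum (s := Finset.range N) (fun n hn => if_neg hn),
        Finset.sum_congr rfl fun n hn => if_pos hn]
      simp
    rw [h3, hN]
    simp
  have hlint : ∫⁻ ω, W ω ∂μ = ENNReal.ofReal (∑' n, μ.real (U n)) := by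
    rw [ENNReal.ofReal_tsum_of_nonneg (fun n => measureReal_nonneg) hs,
      lintegral_tsum fun n => (measurable_one.indicator (hU n)).aemeasurable]
    refine tsum_congr fun n => ?_
    rw [lintegral_indicator_one (hU n), ofReal_measureReal]
  have hfin : ∫⁻ ω, W ω ∂μ ≠ ⊤ := by rw [hlint]; exact ENNReal.ofReal_ne_top
  refine ⟨(integrable_toReal_of_lintegral_ne_top hWm.aemeasurable hfin).congr hWX, ?_⟩
  rw [← integral_congr_ae hWX, integral_toReal hWm.aemeasurable (ae_lt_top hWm hfin), hlint,
    ENNReal.toReal_ofReal (tsum_nonneg fun n => measureReal_nonneg)]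

end Expectation

section TailFactor

lemma tailFactor_one (q : ℕ) : tailFactor q 1 = 0 := by simp [tailFactor]

lemma tailFactor_eq {q n : ℕ} (hq : 2 ≤ q) (hn : n ≠ 0) :
    tailFactor q n = 1 - ((q : ℝ) - 1) / ((q : ℝ) ^ n - 1) := by
  have hq' : (2 : ℝ) ≤ q := by exact_mod_cast hq
  have h1 : (1 : ℝ) < (q : ℝ) ^ n := one_lt_pow₀ (by linarith) hn
  have h2 : (q : ℝ) ^ n - 1 ≠ 0 := by linarith
  rw [tailFactor]
  field_simp
  ring

lemma tailFactor_le_one {q n : ℕ} (hq : 2 ≤ q) (hn : n ≠ 0) : tailFactor q n ≤ 1 := by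
  have hq' : (2 : ℝ) ≤ q := by exact_mod_cast hq
  have h1 : (1 : ℝ) < (q : ℝ) ^ n := one_lt_pow₀ (by linarith) hn
  rw [tailFactor_eq hq hn, sub_le_self_iff]
  exact div_nonneg (by linarith) (by linarith)

lemma tailFactor_two {q : ℕ} (hq : 2 ≤ q) : tailFactor q 2 = (q : ℝ) / (q + 1) := by
  have hq' : (2 : ℝ) ≤ q := by exact_mod_cast hq
  have h1 : (1 : ℝ) < (q : ℝ) ^ 2 := one_lt_pow₀ (by linarith) two_ne_zero
  have h2 : (q : ℝ) ^ 2 - 1 ≠ 0 := by linarith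
  rw [tailFactor]
  field_simp
  ring

lemma tailFactor_lt_tailFactor {q m n : ℕ} (hq : 2 ≤ q) (hm : m ≠ 0) (hmn : m < n) :
    tailFactor q m < tailFactor q n := by
  have hq' : (2 : ℝ) ≤ q := by exact_mod_cast hq
  have h1 : (1 : ℝ) < (q : ℝ) ^ m := one_lt_pow₀ (by linarith) hm
  have h2 : (q : ℝ) ^ m < (q : ℝ) ^ n := pow_lt_pow_right₀ (by linarith) hmn
  rw [tailFactor_eq hq hm, tailFactor_eq hq (by omega)]
  exact sub_lt_sub_left (div_lt_div_of_pos_left (by linarith) (by linarith) (by linarith)) _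

lemma div_add_one_le_tailFactor {q n : ℕ} (hq : 2 ≤ q) (hn : 2 ≤ n) :
    (q : ℝ) / (q + 1) ≤ tailFactor q n := by
  rw [← tailFactor_two hq]
  obtain rfl | hn := hn.eq_or_lt
  · rfl
  · exact (tailFactor_lt_tailFactor hq two_ne_zero hn).le

variable {q : ℕ} {x : ℝ}

lemma one_sub_pow_le_prod_tailFactor (hq : 2 ≤ q) (hx0 : 0 ≤ x) (hx1 : x ≤ 1) (d : ℕ) :
    (1 - x) ^ d ≤ ∏ k : Fin d, (1 - tailFactor q (d - k) * x) := by
  have h := Finset.prod_le_prod (s := (Finset.univ : Finset (Fin d))) (f := fun _ => 1 - x)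
    (g := fun k : Fin d => 1 - tailFactor q (d - k) * x) (fun k _ => by linarith) fun k _ => by
      have hk := k.2
      have := mul_le_mul_of_nonneg_right (tailFactor_le_one hq (n := d - k) (by omega)) hx0
      linarith
  simpa using h

lemma prod_tailFactor_succ (q n : ℕ) (x : ℝ) :
    ∏ k : Fin (n + 1), (1 - tailFactor q (n + 1 - k) * x) =
      ∏ k : Fin n, (1 - tailFactor q (n + 1 - k) * x) := by
  rw [Fin.prod_univ_castSucc]
  simp [tailFactor_one]

lemma prod_tailFactor_le (hq : 2 ≤ q) (hx0 : 0 ≤ x) (hx1 : x ≤ 1) (n : ℕ) :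
    ∏ k : Fin (n + 1), (1 - tailFactor q (n + 1 - k) * x) ≤ (1 - (q : ℝ) / (q + 1) * x) ^ n := by
  rw [prod_tailFactor_succ]
  have h := Finset.prod_le_prod (s := (Finset.univ : Finset (Fin n)))
    (f := fun k : Fin n => 1 - tailFactor q (n + 1 - k) * x)
    (g := fun _ => 1 - (q : ℝ) / (q + 1) * x) (fun k _ => by
      have := mul_le_mul_of_nonneg_right (tailFactor_le_one hq (n := n + 1 - k) (by omega)) hx0
      linarith) fun k _ => by
      have hk := k.2
      have := mul_le_mul_of_nonneg_right
        (div_add_one_le_tailFactor hq (n := n + 1 - k) (by omega)) hx0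
      linarith
  simpa using h

lemma prod_tailFactor_lt (hq : 2 ≤ q) (hx0 : 0 < x) (hx1 : x < 1) {n : ℕ} (hn : 2 ≤ n) :
    ∏ k : Fin (n + 1), (1 - tailFactor q (n + 1 - k) * x) < (1 - (q : ℝ) / (q + 1) * x) ^ n := by
  rw [prod_tailFactor_succ]
  have h := Finset.prod_lt_prod (s := (Finset.univ : Finset (Fin n)))
    (f := fun k : Fin n => 1 - tailFactor q (n + 1 - k) * x)
    (g := fun _ => 1 - (q : ℝ) / (q + 1) * x) (fun k _ => by
      have := mul_le_mul_of_nonneg_right (tailFactor_le_one hq (n := n + 1 - k) (by omega)) hx0.le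
      linarith) (fun k _ => by
      have hk := k.2
      have := mul_le_mul_of_nonneg_right
        (div_add_one_le_tailFactor hq (n := n + 1 - k) (by omega)) hx0.le
      linarith) ⟨⟨0, by omega⟩, Finset.mem_univ _, by
      have h1 := tailFactor_lt_tailFactor hq two_ne_zero (show 2 < n + 1 by omega)
      rw [tailFactor_two hq] at h1
      have := mul_lt_mul_of_pos_right h1 hx0
      simp only [Nat.sub_zero]
      linarith⟩
  simpa using h

end TailFactor

lemma infinite_of_isDiscreteValuationRing (R : Type*) [CommRing R] [IsDomain R]
    [IsDiscreteValuationRing R] : Infinite R := by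
  by_contra h
  have := not_infinite_iff_finite.1 h
  exact IsDiscreteValuationRing.not_isField R (Finite.isField_of_domain R)

end LUStat

open LUStat in
theorem mainTheorem1
    {R : Type*} [CommRing R] [IsDomain R] [IsDiscreteValuationRing R]
    [IsAdicComplete (IsLocalRing.maximalIdeal R) R]
    [Finite (IsLocalRing.ResidueField R)]
    [TopologicalSpace R] (hR : IsAdic (IsLocalRing.maximalIdeal R))
    {K : Type*} [Field K] [Algebra R K] [IsFractionRing R K]
    (q : ℕ) (hq : q = Nat.card (IsLocalRing.ResidueField R))
    (d : ℕ) (hd : 0 < d)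
    [MeasurableSpace (Matrix (Fin d) (Fin d) R)] [BorelSpace (Matrix (Fin d) (Fin d) R)]
    (μ : MeasureTheory.Measure (Matrix (Fin d) (Fin d) R))
    [μ.IsAddHaarMeasure] [MeasureTheory.IsProbabilityMeasure μ] :
    (∀ᵐ ω ∂μ, LUStat.HasUniqueLU (ω.map (algebraMap R K))) ∧
    MeasureTheory.Integrable (fun ω => (LUStat.VL K ω : ℝ)) μ ∧
    Summable (fun v : ℕ => LUStat.Eterm q d (v + 1)) ∧
    LUStat.Eqd q d - 1 / ((q : ℝ) - 1) ≤ ∫ ω, (LUStat.VL K ω : ℝ) ∂μ ∧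
    (3 ≤ d → LUStat.Eqd q d - 1 / ((q : ℝ) - 1) < ∫ ω, (LUStat.VL K ω : ℝ) ∂μ) ∧
    ∫ ω, (LUStat.VL K ω : ℝ) ∂μ ≤ LUStat.Eqd q d ∧
    |LUStat.Eqd q d - Real.logb q d| ≤ 1 / Real.log 2 ∧
    (3 ≤ q → |LUStat.Eqd q d - Real.logb q d| ≤ 1) := by
  have hq2 : 2 ≤ q := hq ▸ two_le_card_residueField (R := R)
  have hq2' : (2 : ℝ) ≤ q := by exact_mod_cast hq2
  have := isTopologicalRing_of_isAdic hR
  have := t2Space_of_isAdic hR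
  have := compactSpace_of_isAdic hR finite_quotient_maximalIdeal_pow
  have := infinite_of_isDiscreteValuationRing R
  obtain ⟨ϖ, hϖ⟩ := IsDiscreteValuationRing.exists_irreducible R
  have hae : ∀ᵐ ω ∂μ, ∀ k : Fin d, minor k k ω ≠ 0 :=
    MeasureTheory.ae_all_iff.2 fun k => ae_minor_ne_zero k
  have hunique : ∀ᵐ ω ∂μ, HasUniqueLU (ω.map (algebraMap R K)) := by
    filter_upwards [hae] with ω hω
    refine hasUniqueLU_of_minor_ne_zero fun k => ?_
    have hmap : minor k k (ω.map (algebraMap R K)) = algebraMap R K (minor k k ω) :=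
      minor_map (algebraMap R K) k k ω
    rw [hmap]
    simpa using hω k
  -- up to a null set, `U n` is the event `n + 1 ≤ V_L`
  set U : ℕ → Set (Matrix (Fin d) (Fin d) R) := fun n => ⋃ k : Fin d, tailSet ϖ k (n + 1) with hU
  have hUm (n : ℕ) : MeasurableSet (U n) :=
    MeasurableSet.iUnion fun k => (isClosed_tailSet ϖ k (n + 1)).measurableSet
  have hVU : ∀ᵐ ω ∂μ, ∀ n : ℕ, ((n + 1 : ℕ) : ℤ) ≤ VL K ω ↔ ω ∈ U n := by
    filter_upwards [hae] with ω hω n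
    rw [le_VL_iff hϖ hd hω]
    simp [hU, tailSet]
  set x : ℕ → ℝ := fun n => ((q : ℝ) ^ (n + 1))⁻¹ with hx
  have hx0 (n : ℕ) : 0 < x n := by positivity
  have hx1 (n : ℕ) : x n < 1 := inv_lt_one_of_one_lt₀ (one_lt_pow₀ (by linarith) (by omega))
  have hUr (n : ℕ) : μ.real (U n) = 1 - ∏ k : Fin d, (1 - tailFactor q (d - k) * x n) := by
    have h1 := measureReal_iInter_compl_tailSet (μ := μ) hR hϖ (Nat.succ_ne_zero n)
    rw [← Set.compl_iUnion, MeasureTheory.probReal_compl_eq_one_sub (hUm n), ← hq] at h1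
    simp only [hx]
    linarith
  have hupper (n : ℕ) : μ.real (U n) ≤ Eterm q d (n + 1) := by
    rw [hUr, Eterm]
    exact sub_le_sub_left (one_sub_pow_le_prod_tailFactor hq2 (hx0 n).le (hx1 n).le d) 1
  have hEs := summable_Eterm hq2 d
  have hUs : Summable fun n => μ.real (U n) :=
    Summable.of_nonneg_of_le (fun n => MeasureTheory.measureReal_nonneg) hupper hEs
  obtain ⟨hint, hexp⟩ := integral_eq_tsum_measureReal (fun ω => VL_nonneg (K := K) hd ω) hUm hVU hUs
  obtain ⟨n, rfl⟩ := Nat.exists_eq_succ_of_ne_zero hd.ne'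
  have ha1 : (q : ℝ) / (q + 1) ≤ 1 := by rw [div_le_one (by linarith)]; linarith
  have hls := summable_one_sub_pow hq2 (a := (q : ℝ) / (q + 1)) (by positivity) ha1 n
  have hlower (v : ℕ) : 1 - (1 - (q : ℝ) / (q + 1) * x v) ^ n ≤ μ.real (U v) := by
    rw [hUr]
    exact sub_le_sub_left (prod_tailFactor_le hq2 (hx0 v).le (hx1 v).le n) 1
  refine ⟨hunique, hint, hEs, ?_, fun hn => ?_, ?_, abs_Eqd_sub_logb_le_inv_log_two hq2 hd,
    fun hq3 => abs_Eqd_sub_logb_le_one hq3 hd⟩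
  · rw [hexp]
    exact (Eqd_succ_sub_le_tsum hq2 n).trans (hls.tsum_le_tsum hlower hUs)
  · rw [hexp]
    refine (Eqd_succ_sub_le_tsum hq2 n).trans_lt (hls.tsum_lt_tsum (i := 0) hlower ?_ hUs)
    rw [hUr]
    exact sub_lt_sub_left (prod_tailFactor_lt hq2 (hx0 0) (hx1 0) (by omega)) 1
  · rw [hexp]
    exact hUs.tsum_le_tsum hupper hEs
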